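/- **Setting.** Consider $n$ qudits of dimension $d$. Fix a group $\mathbf C\subset U(d)$ of easy gates and a non-empty finite twirling set $\mathbf T\subset\mathbf C$. A bare circuit has $K$ cycles. The $k$th cycle ($1\le k\le K$) is a round of easy gates $\vec C_k=C_{1,k}\otimes\cdots\otimes C_{n,k}$ with $C_{j,k}\in\mathbf C$, followed by a round of hard gates whose product is a unitary $G_k$ on the $n$ qudits, with $G_K=I$. Put $G_0=I$. In the randomized compilation the twirling gates $T_{j,k}$ ($1\le j\le n$, $0\le k\le K$) are independent and uniform on $\mathbf T$, except that the gates of each of the edge rounds $k=0$ and $k=K$ may instead all be set to the identity. The corrections $\vec T_k^{c}=G_k\vec T_k^{\dagger}G_k^{\dagger}$, $0\le k<K$, are assumed to be, up to a global phase, tensor products of gates of $\mathbf C$, and the $k$th round of easy gates is replaced by the dressed round $\vec{\tilde C}_k=\vec T_k\vec C_k\vec T_{k-1}^{c}$, whose $j$th tensor factor is $\tilde C_{j,k}=T_{j,k}C_{j,k}T^c_{j,k-1}\in\mathbf C$. We write $\mathbb E_{\vec{\tilde C}_k}$ for the average over the random gates $\vec T_{k-1},\vec T_k$. The noise on the easy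 gates is gate-dependent: to every round $\vec C$ of easy gates there belongs an arbitrary channel (completely positive trace-preserving map) $\mathcal E(\vec C)$ on the $n$ qudits. Let $\mathcal E_k^{\mathbf T}=\mathbb E_{\vec{\tilde C}_k}\mathcal E(\vec{\tilde C}_k)$. For a difference $\Phi$ of channels on a $D$-dimensional system let $\|\Phi\|_\diamond=\sup_\psi\|(\Phi\otimes\mathcal I_D)(|\psi\rangle\langle\psi|)\|_1$ be the diamond norm, with the supremum over pure states of $\mathbb C^D\otimes\mathbb C^D$ and $\|A\|_1=\mathrm{Tr}\sqrt{A^\dagger A}$. For a channel $\mathcal A$ let $\epsilon(\mathcal A)=\tfrac12\|\mathcal A-\mathcal I\|_\diamond$ and $r(\mathcal A)=1-\int d\psi\,\langle\psi|\mathcal A(|\psi\rangle\langle\psi|)|\psi\rangle$, the average infidelity over uniformly distributed pure states. **Theorem.** For arbitrary noise and every $k=1,\dots,K$, $$\mathbb E_{\vec{\tilde C}_k}\bigl\|\mathcal E(\vec{\tilde C}_k)-\mathcal E_k^{\mathbf T}\bigr\|_\diamond\le 2\,\epsilon(\mathcal E_k^{\mathbf T})+2\sqrt{\mathbb E_{\vec{\tilde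 C}_k}\,\epsilon[\mathcal E(\vec{\tilde C}_k)]^2}.$$ If $d=2$ and the noise on the easy gates is local, that is, $\mathcal E(\vec C)=\mathcal E_1(C_1)\otimes\cdots\otimes\mathcal E_n(C_n)$ for every round $\vec C$ of easy gates, where $\mathcal E_j(C)$ is a single-qubit channel for every $j$ and every $C\in\mathbf C$, then for every $k=1,\dots,K$, $$\mathbb E_{\vec{\tilde C}_k}\bigl\|\mathcal E(\vec{\tilde C}_k)-\mathcal E_k^{\mathbf T}\bigr\|_\diamond\le\sum_{j=1}^n4\sqrt{6\,r(\mathcal E_{j,k}^{\mathbf T})},\qquad \mathcal E_{j,k}^{\mathbf T}=\mathbb E_{\vec{\tilde C}_k}\,\mathcal E_j(\tilde C_{j,k}).$$ -/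

import Mathlib

open scoped BigOperators ComplexOrder

noncomputable section

namespace RandomizedCompiling

/-- Linear maps on the complex `ι × ι` matrices (superoperators on a system whose computational
basis is indexed by `ι`). -/
abbrev SuperOp (ι : Type*) : Type _ := Matrix ι ι ℂ →ₗ[ℂ] Matrix ι ι ℂ

/-- The extension `(Φ ⊗ id)(X)` of a superoperator to a system with an ancilla indexed by `κ`. -/
def extend {ι : Type*} (Φ : SuperOp ι) (κ : Type*) (X : Matrix (ι × κ) (ι × κ) ℂ) :
    Matrix (ι × κ) (ι × κ) ℂ :=
  Matrix.of fun p q => Φ (Matrix.of fun i j => X (i, p.2) (j, q.2)) p.1 q.1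

/-- A quantum channel: a completely positive and trace-preserving superoperator. -/
structure IsChannel {ι : Type*} [Fintype ι] (Φ : SuperOp ι) : Prop where
  completely_positive : ∀ (m : ℕ) (X : Matrix (ι × Fin m) (ι × Fin m) ℂ),
    X.PosSemidef → (extend Φ (Fin m) X).PosSemidef
  trace_preserving : ∀ X : Matrix ι ι ℂ, (Φ X).trace = X.trace

/-- The trace norm `‖A‖₁ = Tr √(A† A)`, the sum of the singular values of `A`. -/
def traceNorm {ι : Type*} [Fintype ι] [DecidableEq ι] (A : Matrix ι ι ℂ) : ℝ :=
  ∑ i, Real.sqrt ((Matrix.isHermitian_conjTranspose_mul_self A).eigenvalues i)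

/-- The rank-one operator `|ψ⟩⟨ψ|`. -/
def ketBra {ι : Type*} (ψ : EuclideanSpace ℂ ι) : Matrix ι ι ℂ :=
  Matrix.of fun i j => ψ i * star (ψ j)

/-- The diamond norm `‖Φ‖_⋄ = sup_ψ ‖(Φ ⊗ id)(|ψ⟩⟨ψ|)‖₁`, the supremum being over all pure states
`ψ` of the system together with an ancilla of the same dimension. This is the form of the diamond
norm for Hermiticity-preserving maps; it is applied only to differences of channels. -/
def diamondNorm {ι : Type*} [Fintype ι] [DecidableEq ι] (Φ : SuperOp ι) : ℝ :=
  ⨆ ψ : Metric.sphere (0 : EuclideanSpace ℂ (ι × ι)) 1,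
    traceNorm (extend Φ ι (ketBra (ψ : EuclideanSpace ℂ (ι × ι))))

/-- The worst-case error rate `ε(Φ) = ½ ‖Φ - id‖_⋄`. -/
def worstCaseError {ι : Type*} [Fintype ι] [DecidableEq ι] (Φ : SuperOp ι) : ℝ :=
  (1 / 2) * diamondNorm (Φ - LinearMap.id)

/-- The average infidelity `r(Φ) = 1 - ∫ dψ ⟨ψ| Φ(|ψ⟩⟨ψ|) |ψ⟩`, where `dψ` is the uniform
probability measure on the unit sphere of pure states (the bar in `⨍` divides the surface measure
by its total mass). -/
def infidelity {ι : Type*} [Fintype ι] (Φ : SuperOp ι) : ℝ :=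
  1 - ⨍ ψ : Metric.sphere (0 : EuclideanSpace ℂ ι) 1,
    (∑ i, ∑ j, star ((ψ : EuclideanSpace ℂ ι) i) *
      Φ (ketBra (ψ : EuclideanSpace ℂ ι)) i j * (ψ : EuclideanSpace ℂ ι) j).re
    ∂((MeasureTheory.volume : MeasureTheory.Measure (EuclideanSpace ℂ ι)).toSphere)

/-- The basis of `n` qudits of dimension `d`. -/
abbrev Qudits (n d : ℕ) : Type := Fin n → Fin d

/-- The tensor product `A₁ ⊗ ⋯ ⊗ Aₙ` of operators on the individual qudits. -/
def tensorMatrix {n d : ℕ} (A : Fin n → Matrix (Fin d) (Fin d) ℂ) :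
    Matrix (Qudits n d) (Qudits n d) ℂ :=
  Matrix.of fun p q => ∏ j, A j (p j) (q j)

/-- The tensor product `Φ₁ ⊗ ⋯ ⊗ Φₙ` of superoperators on the individual qudits: the linear map
that sends each matrix unit `|a⟩⟨b| = ⨂ⱼ |aⱼ⟩⟨bⱼ|` to `⨂ⱼ Φⱼ(|aⱼ⟩⟨bⱼ|)`. -/
def tensorSuperOp {n d : ℕ} (Φ : Fin n → SuperOp (Fin d)) : SuperOp (Qudits n d) where
  toFun X := ∑ a : Qudits n d, ∑ b : Qudits n d,
    X a b • tensorMatrix fun j => Φ j (Matrix.single (a j) (b j) 1)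
  map_add' X Y := by
    simp only [Matrix.add_apply, add_smul, Finset.sum_add_distrib]
  map_smul' c X := by
    simp only [Matrix.smul_apply, smul_assoc, Finset.smul_sum, RingHom.id_apply]

/-- A bare circuit of `K` cycles on `n` qudits of dimension `d`, with the data of its randomized
compilation. The cycle written `k + 1` in one-based numbering is indexed by `k : Fin K`; rounds of
twirling gates and of hard gates are indexed by `Fin (K + 1)`, so that the cycle `k : Fin K` lies
between the rounds `k.castSucc` and `k.succ`. -/
structure Circuit (d n K : ℕ) where
  /-- The group `𝐂` generated by the easy gates. -/
  easy : Subgroup (Matrix.unitaryGroup (Fin d) ℂ)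
  /-- The twirling set `𝐓`, a subset of `𝐂`. -/
  twirl : Finset easy
  twirl_nonempty : twirl.Nonempty
  /-- The easy gate of each cycle on each qudit. -/
  easyGate : Fin K → Fin n → easy
  /-- The rounds `G_k` of hard gates; `G_0` is fictitious. -/
  hardRound : Fin (K + 1) → Matrix.unitaryGroup (Qudits n d) ℂ
  hardRound_zero : hardRound 0 = 1
  hardRound_last : hardRound (Fin.last K) = 1
  /-- The set from which the twirling gates of each round are drawn: `𝐓`, except that the two
  edge rounds may instead be set to the identity. -/
  twirlAt : Fin (K + 1) → Finset easy
  twirlAt_eq : ∀ k, twirlAt k = twirl ∨ ((k = 0 ∨ k = Fin.last K) ∧ twirlAt k = {1})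
  /-- The local gates whose tensor product is the correction `T_k^c`. -/
  correction : Fin (K + 1) → (Fin n → easy) → (Fin n → easy)
  /-- `T_k^c = G_k T_k† G_k†`, up to a global phase. -/
  correction_eq : ∀ k T, (∀ j, T j ∈ twirlAt k) → ∃ z : ℂ, ‖z‖ = 1 ∧
    tensorMatrix (fun j => ((correction k T j : Matrix.unitaryGroup (Fin d) ℂ) :
        Matrix (Fin d) (Fin d) ℂ)) =
      z • ((hardRound k : Matrix (Qudits n d) (Qudits n d) ℂ) *
        (tensorMatrix fun j => ((T j : Matrix.unitaryGroup (Fin d) ℂ) :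
          Matrix (Fin d) (Fin d) ℂ)).conjTranspose *
        (hardRound k : Matrix (Qudits n d) (Qudits n d) ℂ).conjTranspose)

namespace Circuit

variable {d n K : ℕ} (Q : Circuit d n K)

/-- The possible values of the pair of twirling rounds before and after the easy gates of a cycle;
all the twirling gates are independent and uniform, that is, the pair is uniform on this set. -/
def twirlPairs (k : Fin K) : Finset ((Fin n → Q.easy) × (Fin n → Q.easy)) :=
  (Fintype.piFinset fun _ => Q.twirlAt k.castSucc) ×ˢ (Fintype.piFinset fun _ => Q.twirlAt k.succ)

/-- The round of dressed gates `T_k C_k T_{k-1}^c`, as a function of the pair `(T_{k-1}, T_k)`. -/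
def dressed (k : Fin K) (T : (Fin n → Q.easy) × (Fin n → Q.easy)) : Fin n → Q.easy :=
  fun j => T.2 j * Q.easyGate k j * Q.correction k.castSucc T.1 j

/-- The noise averaged over the dressed gates of a cycle. -/
def averagedNoise (k : Fin K) (E : (Fin n → Q.easy) → SuperOp (Qudits n d)) :
    SuperOp (Qudits n d) :=
  𝔼 T ∈ Q.twirlPairs k, E (Q.dressed k T)

/-- The noise on the `j`-th qudit averaged over the dressed gates of a cycle. -/
def averagedLocalNoise (k : Fin K) (j : Fin n) (E : Q.easy → SuperOp (Fin d)) :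
    SuperOp (Fin d) :=
  𝔼 T ∈ Q.twirlPairs k, E (Q.dressed k T j)

end Circuit

end RandomizedCompiling

end

/-! Both bounds compare a noise channel E(C) with the average Ē through the identity: ‖E(C) - Ē‖ ≤
‖E(C) - id‖ + ‖Ē - id‖ in diamond norm. For arbitrary noise, averaging this and applying
Cauchy–Schwarz to the mean of ε gives the claim.

For local noise both terms reduce to one-qubit quantities. The telescoping Φ∘Ψ - id = (Φ - id) +
Φ∘(Ψ - id), together with contractivity of the trace norm under channels, makes the distance to the
identity subadditive over tensor factors (`isChannel_tensorSuperOp_and_stableBound`), and convexity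
carries the bound over to Ē (`StableBound.expect`). For a single system, the output on any pure
input arises from the unnormalized Choi matrix J(Φ) by an ancilla operator that does not raise
traces of positive matrices, so the distance is at most ‖J(Φ) - J(id)‖₁. As J(id) = |Ω⟩⟨Ω| is pure,
the Fuchs–van de Graaf inequality bounds this by 2√(d² - ⟨Ω|J(Φ)|Ω⟩) (`stableBound_sub_id`). For a
qubit, the fourth moments of the uniform measure on pure states identify the radicand with 6r
(`six_mul_infidelity`). Finally r is affine in the map, so Jensen turns the mean of √(6r) into √(6r)
of the mean. The constant 4 is the 2 of Fuchs–van de Graaf, doubled by the triangle inequality. -/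

noncomputable section

namespace RandomizedCompiling

open Matrix MeasureTheory

/-! ### The trace norm of Hermitian matrices -/

section TraceNorm

variable {ι κ : Type*} [Fintype ι] [DecidableEq ι] [Fintype κ] [DecidableEq κ]

/-- Here A†A = A², whose characteristic polynomial has the squared eigenvalues of A as roots.
Comparing multisets of roots avoids matching the two orderings of eigenvalues. -/
theorem traceNorm_eq_sum_abs_eigenvalues {A : Matrix ι ι ℂ} (hA : A.IsHermitian) :
    traceNorm A = ∑ i, |hA.eigenvalues i| := by
  have hsq : A.conjTranspose * A = cfc (fun x : ℝ => x ^ 2) A := by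
    rw [cfc_pow_id (R := ℝ) A 2 hA.isSelfAdjoint, hA.eq, sq]
  have hroots : Multiset.map
      (((↑) : ℝ → ℂ) ∘ (Matrix.isHermitian_conjTranspose_mul_self A).eigenvalues) Finset.univ.val =
      Multiset.map (fun i => ((hA.eigenvalues i ^ 2 : ℝ) : ℂ)) Finset.univ.val := by
    have h := (Matrix.isHermitian_conjTranspose_mul_self A).roots_charpoly_eq_eigenvalues
    have h' := hA.charpoly_cfc_eq (fun x : ℝ => x ^ 2)
    rw [← hsq] at h'
    rw [h', Polynomial.roots_prod _ _ (Finset.prod_ne_zero_iff.mpr fun i _ => Polynomial.X_sub_C_ne_zero _)] at h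
    simp only [Polynomial.roots_X_sub_C, Multiset.bind_singleton] at h
    exact h.symm
  have h := congrArg (fun s => (s.map (fun z : ℂ => Real.sqrt z.re)).sum) hroots
  simp only [Multiset.map_map, Function.comp_def, Complex.ofReal_re, Real.sqrt_sq_eq_abs] at h
  exact h

/-- In an eigenbasis of P - N each eigenvalue is a difference of diagonal entries of P and N, both
nonnegative, so its modulus is at most their sum. -/
theorem traceNorm_sub_le_trace_add_trace {P N : Matrix ι ι ℂ} (hP : P.PosSemidef) (hN : N.PosSemidef) :
    traceNorm (P - N) ≤ P.trace.re + N.trace.re := by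
  have hA : (P - N).IsHermitian := hP.isHermitian.sub hN.isHermitian
  rw [traceNorm_eq_sum_abs_eigenvalues hA]
  set U : Matrix ι ι ℂ := hA.eigenvectorUnitary.1 with hU
  have hUU : U * U.conjTranspose = 1 := Unitary.mul_star_self_of_mem hA.eigenvectorUnitary.2
  have htr (X : Matrix ι ι ℂ) : (U.conjTranspose * X * U).trace = X.trace := by
    rw [Matrix.trace_mul_comm, ← Matrix.mul_assoc, hUU, Matrix.one_mul]
  have hdiag : U.conjTranspose * (P - N) * U = diagonal (RCLike.ofReal ∘ hA.eigenvalues) := by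
    rw [← hA.conjStarAlgAut_star_eigenvectorUnitary, Unitary.conjStarAlgAut_apply]
    simp [hU, Matrix.star_eq_conjTranspose]
  have hP' := hP.conjTranspose_mul_mul_same U
  have hN' := hN.conjTranspose_mul_mul_same U
  rw [← htr P, ← htr N, Matrix.trace, Matrix.trace, Complex.re_sum, Complex.re_sum,
    ← Finset.sum_add_distrib]
  refine Finset.sum_le_sum fun i _ => ?_
  have h1 := congrFun (congrFun hdiag i) i
  rw [Matrix.mul_sub, Matrix.sub_mul, Matrix.sub_apply, Matrix.diagonal_apply_eq] at h1
  have h2 := congrArg Complex.re h1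
  have h3 := (Complex.le_def.mp (hP'.diag_nonneg (i := i))).1
  have h4 := (Complex.le_def.mp (hN'.diag_nonneg (i := i))).1
  simp only [Complex.sub_re, Function.comp_apply, Complex.zero_re, Matrix.diag_apply,
    Complex.coe_algebraMap, Complex.ofReal_re] at h2 h3 h4 ⊢
  rw [← h2]
  exact abs_le.mpr ⟨by linarith, by linarith⟩

/-- The Jordan decomposition attains the previous bound. The trace norm is thus the minimum of Tr P
+ Tr N over such splittings, and the norm inequalities below follow by splitting, transforming both
parts and adding traces. -/
theorem exists_posSemidef_sub_eq {A : Matrix ι ι ℂ} (hA : A.IsHermitian) :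
    ∃ P N : Matrix ι ι ℂ, P.PosSemidef ∧ N.PosSemidef ∧ A = P - N ∧
      P.trace.re + N.trace.re = traceNorm A := by
  set U : Matrix ι ι ℂ := hA.eigenvectorUnitary.1 with hU
  have hUU : U.conjTranspose * U = 1 := Unitary.star_mul_self_of_mem hA.eigenvectorUnitary.2
  have hpsd (f : ι → ℝ) (hf : ∀ i, 0 ≤ f i) :
      (U * diagonal (fun i => (f i : ℂ)) * U.conjTranspose).PosSemidef :=
    (PosSemidef.diagonal (fun i => Complex.zero_le_real.mpr (hf i))).mul_mul_conjTranspose_same U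
  have htr (f : ι → ℝ) :
      (U * diagonal (fun i => (f i : ℂ)) * U.conjTranspose).trace.re = ∑ i, f i := by
    rw [Matrix.trace_mul_comm, ← Matrix.mul_assoc, hUU, Matrix.one_mul, trace_diagonal]
    simp
  refine ⟨_, _, hpsd (fun i => (hA.eigenvalues i)⁺) fun i => posPart_nonneg _,
    hpsd (fun i => (hA.eigenvalues i)⁻) fun i => negPart_nonneg _, ?_, ?_⟩
  · rw [← Matrix.sub_mul, ← Matrix.mul_sub, diagonal_sub]
    conv_lhs => rw [hA.spectral_theorem, Unitary.conjStarAlgAut_apply]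
    simp only [← Complex.ofReal_sub, posPart_sub_negPart]
    rfl
  · rw [htr, htr, traceNorm_eq_sum_abs_eigenvalues hA, ← Finset.sum_add_distrib]
    simp only [posPart_add_negPart]

theorem traceNorm_nonneg (A : Matrix ι ι ℂ) : 0 ≤ traceNorm A :=
  Finset.sum_nonneg fun _ _ => Real.sqrt_nonneg _

theorem traceNorm_zero : traceNorm (0 : Matrix ι ι ℂ) = 0 :=
  le_antisymm (by simpa using traceNorm_sub_le_trace_add_trace (ι := ι) PosSemidef.zero PosSemidef.zero)
    (traceNorm_nonneg _)

theorem traceNorm_add_le {A B : Matrix ι ι ℂ} (hA : A.IsHermitian) (hB : B.IsHermitian) :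
    traceNorm (A + B) ≤ traceNorm A + traceNorm B := by
  obtain ⟨P, N, hP, hN, hPN, h⟩ := exists_posSemidef_sub_eq hA
  obtain ⟨P', N', hP', hN', hPN', h'⟩ := exists_posSemidef_sub_eq hB
  have := traceNorm_sub_le_trace_add_trace (hP.add hP') (hN.add hN')
  rw [show P + P' - (N + N') = A + B by rw [hPN, hPN']; abel] at this
  simp only [trace_add, Complex.add_re] at this
  linarith

theorem traceNorm_sub_le {A B : Matrix ι ι ℂ} (hA : A.IsHermitian) (hB : B.IsHermitian) :
    traceNorm (A - B) ≤ traceNorm A + traceNorm B := by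
  obtain ⟨P, N, hP, hN, hPN, h⟩ := exists_posSemidef_sub_eq hA
  obtain ⟨P', N', hP', hN', hPN', h'⟩ := exists_posSemidef_sub_eq hB
  have := traceNorm_sub_le_trace_add_trace (hP.add hN') (hN.add hP')
  rw [show P + N' - (N + P') = A - B by rw [hPN, hPN']; abel] at this
  simp only [trace_add, Complex.add_re] at this
  linarith

theorem traceNorm_submatrix_le {A : Matrix ι ι ℂ} (hA : A.IsHermitian) (e : κ ≃ ι) :
    traceNorm (A.submatrix e e) ≤ traceNorm A := by
  obtain ⟨P, N, hP, hN, hPN, h⟩ := exists_posSemidef_sub_eq hA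
  have htr (X : Matrix ι ι ℂ) : (X.submatrix e e).trace = X.trace :=
    e.sum_comp fun i => X i i
  have := traceNorm_sub_le_trace_add_trace (hP.submatrix e) (hN.submatrix e)
  rw [htr, htr, h] at this
  rwa [show A.submatrix e e = P.submatrix e e - N.submatrix e e by rw [hPN]; rfl]

theorem traceNorm_smul_le {A : Matrix ι ι ℂ} (hA : A.IsHermitian) {c : ℝ} (hc : 0 ≤ c) :
    traceNorm (c • A) ≤ c * traceNorm A := by
  obtain ⟨P, N, hP, hN, hPN, h⟩ := exists_posSemidef_sub_eq hA
  have := traceNorm_sub_le_trace_add_trace (hP.smul hc) (hN.smul hc)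
  rw [← smul_sub, ← hPN] at this
  refine this.trans_eq ?_
  rw [← h, trace_smul, trace_smul, Complex.smul_re, Complex.smul_re, smul_eq_mul, smul_eq_mul,
    mul_add]

theorem traceNorm_sum_le {σ : Type*} (s : Finset σ) {A : σ → Matrix ι ι ℂ}
    (hA : ∀ t ∈ s, (A t).IsHermitian) :
    traceNorm (∑ t ∈ s, A t) ≤ ∑ t ∈ s, traceNorm (A t) := by
  classical
  induction s using Finset.induction_on with
  | empty => simp [traceNorm_zero]
  | insert a s ha ih =>
    rw [Finset.sum_insert ha, Finset.sum_insert ha]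
    have h1 : ∀ t ∈ s, (A t).IsHermitian := fun t ht => hA t (Finset.mem_insert_of_mem ht)
    have h2 : (∑ t ∈ s, A t).IsHermitian := isSelfAdjoint_sum s h1
    exact (traceNorm_add_le (hA a (Finset.mem_insert_self a s)) h2).trans
      (add_le_add_right (ih h1) _)

/-- Cauchy–Schwarz over the nonzero singular values, whose number is the rank. -/
theorem traceNorm_le_sqrt_rank_mul (A : Matrix ι ι ℂ) :
    traceNorm A ≤ Real.sqrt (A.rank * (A.conjTranspose * A).trace.re) := by
  set hH := Matrix.isHermitian_conjTranspose_mul_self A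
  have hnn : ∀ i, 0 ≤ hH.eigenvalues i := fun i =>
    (posSemidef_conjTranspose_mul_self A).eigenvalues_nonneg i
  have hrank : (A.rank : ℝ) = (Finset.univ.filter fun i => hH.eigenvalues i ≠ 0).card := by
    rw [← rank_conjTranspose_mul_self, hH.rank_eq_card_non_zero_eigs, Fintype.card_subtype]
  have htr : (A.conjTranspose * A).trace.re = ∑ i, hH.eigenvalues i := by
    rw [hH.trace_eq_sum_eigenvalues, Complex.re_sum]
    rfl
  apply Real.le_sqrt_of_sq_le
  have hsum : traceNorm A =
      ∑ i ∈ Finset.univ.filter (fun i => hH.eigenvalues i ≠ 0), Real.sqrt (hH.eigenvalues i) := by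
    rw [Finset.sum_filter_of_ne]
    · rfl
    · intro i _ h h0
      exact h (by rw [h0, Real.sqrt_zero])
  rw [hsum, hrank, htr]
  refine sq_sum_le_card_mul_sum_sq.trans ?_
  refine mul_le_mul_of_nonneg_left ?_ (Nat.cast_nonneg _)
  simp only [Real.sq_sqrt (hnn _)]
  exact Finset.sum_le_univ_sum_of_nonneg hnn

end TraceNorm

/-! ### Channels, the diamond norm and bounds uniform in the ancilla -/

section Channels

variable {ι κ : Type*}

theorem extend_sub (Φ Ψ : SuperOp ι) (X : Matrix (ι × κ) (ι × κ) ℂ) :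
    extend (Φ - Ψ) κ X = extend Φ κ X - extend Ψ κ X := rfl

theorem extend_id (X : Matrix (ι × κ) (ι × κ) ℂ) : extend LinearMap.id κ X = X := rfl

theorem extend_smul (c : ℝ) (Φ : SuperOp ι) (X : Matrix (ι × κ) (ι × κ) ℂ) :
    extend (c • Φ) κ X = c • extend Φ κ X := rfl

theorem extend_sum {σ : Type*} (s : Finset σ) (Φ : σ → SuperOp ι)
    (X : Matrix (ι × κ) (ι × κ) ℂ) :
    extend (∑ t ∈ s, Φ t) κ X = ∑ t ∈ s, extend (Φ t) κ X := by
  ext p q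
  simp only [extend, LinearMap.sum_apply, Matrix.sum_apply, Matrix.of_apply]

theorem extend_comp (Φ Ψ : SuperOp ι) (X : Matrix (ι × κ) (ι × κ) ℂ) :
    extend (Φ ∘ₗ Ψ) κ X = extend Φ κ (extend Ψ κ X) := rfl

theorem extend_map_sub (Φ : SuperOp ι) (X Y : Matrix (ι × κ) (ι × κ) ℂ) :
    extend Φ κ (X - Y) = extend Φ κ X - extend Φ κ Y := by
  ext p q
  exact congrFun (congrFun (map_sub Φ (Matrix.of fun i j => X (i, p.2) (j, q.2))
    (Matrix.of fun i j => Y (i, p.2) (j, q.2))) p.1) q.1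

variable [Fintype ι] [Fintype κ]

theorem posSemidef_ketBra (ψ : EuclideanSpace ℂ ι) : (ketBra ψ).PosSemidef :=
  posSemidef_vecMulVec_self_star (ψ : ι → ℂ)

theorem trace_ketBra (ψ : EuclideanSpace ℂ ι) : (ketBra ψ).trace = ((‖ψ‖ ^ 2 : ℝ) : ℂ) := by
  rw [EuclideanSpace.norm_sq_eq, Matrix.trace, Complex.ofReal_sum]
  refine Finset.sum_congr rfl fun i _ => ?_
  simp only [ketBra, Matrix.diag_apply, Matrix.of_apply, Complex.star_def, Complex.mul_conj,
    Complex.normSq_eq_norm_sq]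

theorem trace_extend {Φ : SuperOp ι} (hΦ : IsChannel Φ) (X : Matrix (ι × κ) (ι × κ) ℂ) :
    (extend Φ κ X).trace = X.trace := by
  simp only [Matrix.trace, Matrix.diag_apply, Fintype.sum_prod_type_right]
  exact Finset.sum_congr rfl fun k _ => hΦ.trace_preserving (Matrix.of fun i j => X (i, k) (j, k))

/-- Complete positivity is posited for the ancillas `Fin m`; relabelling transfers it to every
finite ancilla. -/
theorem posSemidef_extend {Φ : SuperOp ι} (hΦ : IsChannel Φ)
    {X : Matrix (ι × κ) (ι × κ) ℂ} (hX : X.PosSemidef) : (extend Φ κ X).PosSemidef := by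
  let e := Fintype.equivFin κ
  have h := (hΦ.completely_positive _ _
    (hX.submatrix (Prod.map id e.symm))).submatrix (Prod.map id e)
  convert h using 1
  ext p q
  simp [extend, e]

theorem isHermitian_extend_sub {Φ Ψ : SuperOp ι} (hΦ : IsChannel Φ) (hΨ : IsChannel Ψ)
    {X : Matrix (ι × κ) (ι × κ) ℂ} (hX : X.PosSemidef) :
    (extend (Φ - Ψ) κ X).IsHermitian :=
  (posSemidef_extend hΦ hX).isHermitian.sub (posSemidef_extend hΨ hX).isHermitian

theorem isChannel_id : IsChannel (LinearMap.id : SuperOp ι) :=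
  ⟨fun _ _ hX => hX, fun _ => rfl⟩

theorem IsChannel.comp {Φ Ψ : SuperOp ι} (hΦ : IsChannel Φ) (hΨ : IsChannel Ψ) :
    IsChannel (Φ ∘ₗ Ψ) :=
  ⟨fun m _ hX => hΦ.completely_positive m _ (hΨ.completely_positive m _ hX),
    fun X => (hΦ.trace_preserving _).trans (hΨ.trace_preserving X)⟩

theorem expect_eq_smul_sum {σ V : Type*} [AddCommGroup V] [Module ℚ≥0 V] [Module ℝ V] (s : Finset σ)
    (f : σ → V) : 𝔼 t ∈ s, f t = ((s.card : ℝ)⁻¹ : ℝ) • ∑ t ∈ s, f t := by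
  rw [Finset.expect, ← NNRat.cast_smul_eq_nnqsmul ℝ]
  simp

theorem IsChannel.expect {σ : Type*} {s : Finset σ} (hs : s.Nonempty) {Φ : σ → SuperOp ι}
    (hΦ : ∀ t ∈ s, IsChannel (Φ t)) : IsChannel (𝔼 t ∈ s, Φ t) := by
  rw [expect_eq_smul_sum]
  have hc : (s.card : ℝ) ≠ 0 := Nat.cast_ne_zero.mpr hs.card_ne_zero
  refine ⟨fun m X hX => ?_, fun X => ?_⟩
  · rw [extend_smul, extend_sum]
    exact (posSemidef_sum s fun t ht => (hΦ t ht).completely_positive m X hX).smul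
      (inv_nonneg.mpr (Nat.cast_nonneg _))
  · rw [LinearMap.smul_apply, LinearMap.sum_apply, trace_smul, trace_sum,
      Finset.sum_congr rfl fun t ht => (hΦ t ht).trace_preserving X, Finset.sum_const,
      ← Nat.cast_smul_eq_nsmul ℝ, smul_smul, inv_mul_cancel₀ hc, one_smul]

variable [DecidableEq ι] [DecidableEq κ]

/-- A channel sends a Jordan decomposition to a difference of positive matrices with the same
traces. -/
theorem traceNorm_extend_le {Φ : SuperOp ι} (hΦ : IsChannel Φ) {X : Matrix (ι × κ) (ι × κ) ℂ}
    (hX : X.IsHermitian) : traceNorm (extend Φ κ X) ≤ traceNorm X := by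
  obtain ⟨P, N, hP, hN, hPN, h⟩ := exists_posSemidef_sub_eq hX
  rw [← h, hPN, extend_map_sub, ← trace_extend hΦ P, ← trace_extend hΦ N]
  exact traceNorm_sub_le_trace_add_trace (posSemidef_extend hΦ hP) (posSemidef_extend hΦ hN)

theorem traceNorm_extend_sub_le_two {Φ Ψ : SuperOp ι} (hΦ : IsChannel Φ) (hΨ : IsChannel Ψ)
    {ψ : EuclideanSpace ℂ (ι × κ)} (hψ : ‖ψ‖ = 1) :
    traceNorm (extend (Φ - Ψ) κ (ketBra ψ)) ≤ 2 := by
  have h := traceNorm_sub_le_trace_add_trace (posSemidef_extend hΦ (posSemidef_ketBra ψ))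
    (posSemidef_extend hΨ (posSemidef_ketBra ψ))
  rw [trace_extend hΦ, trace_extend hΨ, trace_ketBra, hψ] at h
  rw [extend_sub]
  norm_num at h
  linarith

theorem diamondNorm_nonneg (Φ : SuperOp ι) : 0 ≤ diamondNorm Φ :=
  Real.iSup_nonneg fun _ => traceNorm_nonneg _

theorem traceNorm_extend_le_diamondNorm {Φ Ψ : SuperOp ι} (hΦ : IsChannel Φ) (hΨ : IsChannel Ψ)
    (ψ : Metric.sphere (0 : EuclideanSpace ℂ (ι × ι)) 1) :
    traceNorm (extend (Φ - Ψ) ι (ketBra (ψ : EuclideanSpace ℂ (ι × ι)))) ≤ diamondNorm (Φ - Ψ) := by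
  -- A real supremum dominates its members only if they are bounded; 2 is a bound for differences of
  -- channels.
  refine le_ciSup (f := fun ψ : Metric.sphere (0 : EuclideanSpace ℂ (ι × ι)) 1 =>
    traceNorm (extend (Φ - Ψ) ι (ketBra (ψ : EuclideanSpace ℂ (ι × ι))))) ⟨2, ?_⟩ ψ
  rintro _ ⟨φ, rfl⟩
  exact traceNorm_extend_sub_le_two hΦ hΨ (mem_sphere_zero_iff_norm.mp φ.2)

theorem diamondNorm_sub_le {Φ Ψ Θ : SuperOp ι} (hΦ : IsChannel Φ) (hΨ : IsChannel Ψ)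
    (hΘ : IsChannel Θ) :
    diamondNorm (Φ - Ψ) ≤ diamondNorm (Φ - Θ) + diamondNorm (Ψ - Θ) := by
  -- The bound must be nonnegative because the sphere is empty for empty `ι`, and the supremum is
  -- then 0.
  refine Real.iSup_le (fun ψ => ?_) (add_nonneg (diamondNorm_nonneg _) (diamondNorm_nonneg _))
  have hψ := posSemidef_ketBra (ψ : EuclideanSpace ℂ (ι × ι))
  rw [← sub_sub_sub_cancel_right Φ Ψ Θ, extend_sub]
  exact (traceNorm_sub_le (isHermitian_extend_sub hΦ hΘ hψ)
    (isHermitian_extend_sub hΨ hΘ hψ)).trans (add_le_add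
      (traceNorm_extend_le_diamondNorm hΦ hΘ ψ) (traceNorm_extend_le_diamondNorm hΨ hΘ ψ))

theorem diamondNorm_sub_le_worstCaseError {Φ Ψ : SuperOp ι} (hΦ : IsChannel Φ)
    (hΨ : IsChannel Ψ) :
    diamondNorm (Φ - Ψ) ≤ 2 * worstCaseError Φ + 2 * worstCaseError Ψ := by
  have := diamondNorm_sub_le hΦ hΨ isChannel_id
  unfold worstCaseError
  linarith

theorem expect_le_sqrt_expect_sq {σ : Type*} (s : Finset σ) (f : σ → ℝ) :
    𝔼 t ∈ s, f t ≤ Real.sqrt (𝔼 t ∈ s, f t ^ 2) := by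
  apply Real.le_sqrt_of_sq_le
  rcases s.eq_empty_or_nonempty with rfl | hs
  · simp
  have hc : (0 : ℝ) < s.card := Nat.cast_pos.mpr hs.card_pos
  rw [Finset.expect_eq_sum_div_card, Finset.expect_eq_sum_div_card, div_pow, div_le_div_iff₀
    (by positivity) hc]
  nlinarith [sq_sum_le_card_mul_sum_sq (s := s) (f := f)]

/-- The trace norm of `(Φ ⊗ id)(|ψ⟩⟨ψ|)` is at most `c` for every pure state `ψ` and every finite
ancilla. -/
def StableBound (Φ : SuperOp ι) (c : ℝ) : Prop :=
  ∀ (κ : Type) [Fintype κ] [DecidableEq κ] (ψ : EuclideanSpace ℂ (ι × κ)), ‖ψ‖ = 1 →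
    traceNorm (extend Φ κ (ketBra ψ)) ≤ c

/-- The ancillas range over `Type`, so the system must live there to serve as its own ancilla. -/
theorem StableBound.diamondNorm_le {ι : Type} [Fintype ι] [DecidableEq ι] {Φ : SuperOp ι} {c : ℝ}
    (h : StableBound Φ c) (hc : 0 ≤ c) : diamondNorm Φ ≤ c :=
  Real.iSup_le (fun ψ => h ι ψ (mem_sphere_zero_iff_norm.mp ψ.2)) hc

theorem stableBound_id_sub_id : StableBound (LinearMap.id - LinearMap.id : SuperOp ι) 0 := by
  intro κ _ _ ψ _
  rw [extend_sub, sub_self, traceNorm_zero]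

/-- Telescoping: Φ∘Ψ - id = (Φ - id) + Φ∘(Ψ - id), and the channel Φ contracts the second term. -/
theorem StableBound.comp {Φ Ψ : SuperOp ι} {a b : ℝ} (hΦ : IsChannel Φ) (hΨ : IsChannel Ψ)
    (ha : StableBound (Φ - LinearMap.id) a) (hb : StableBound (Ψ - LinearMap.id) b) :
    StableBound (Φ ∘ₗ Ψ - LinearMap.id) (a + b) := by
  intro κ _ _ ψ hψ
  have hpsd := posSemidef_ketBra ψ
  have hH := isHermitian_extend_sub hΨ isChannel_id hpsd
  have hsplit : extend (Φ ∘ₗ Ψ - LinearMap.id) κ (ketBra ψ) =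
      extend (Φ - LinearMap.id) κ (ketBra ψ) +
        extend Φ κ (extend (Ψ - LinearMap.id) κ (ketBra ψ)) := by
    rw [extend_sub Ψ, extend_map_sub, extend_sub, extend_sub, extend_comp, extend_id]
    abel
  have hH' : (extend Φ κ (extend (Ψ - LinearMap.id) κ (ketBra ψ))).IsHermitian := by
    rw [extend_sub, extend_map_sub]
    exact (posSemidef_extend hΦ (posSemidef_extend hΨ hpsd)).isHermitian.sub
      (posSemidef_extend hΦ hpsd).isHermitian
  rw [hsplit]
  exact (traceNorm_add_le (isHermitian_extend_sub hΦ isChannel_id hpsd) hH').trans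
    (add_le_add (ha κ ψ hψ) ((traceNorm_extend_le hΦ hH).trans (hb κ ψ hψ)))

/-- Convexity of the trace norm. This is needed because an average of product channels need not be a
product. -/
theorem StableBound.expect {σ : Type*} {s : Finset σ} (hs : s.Nonempty) {Φ : σ → SuperOp ι}
    (hΦ : ∀ t ∈ s, IsChannel (Φ t)) {c : σ → ℝ}
    (hc : ∀ t ∈ s, StableBound (Φ t - LinearMap.id) (c t)) :
    StableBound ((𝔼 t ∈ s, Φ t) - LinearMap.id) (𝔼 t ∈ s, c t) := by
  intro κ _ _ ψ hψ
  have hpsd := posSemidef_ketBra ψ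
  have hsplit : (𝔼 t ∈ s, Φ t) - LinearMap.id = 𝔼 t ∈ s, (Φ t - LinearMap.id) := by
    rw [Finset.expect_sub_distrib, Finset.expect_const hs]
  have hH : ∀ t ∈ s, (extend (Φ t - LinearMap.id) κ (ketBra ψ)).IsHermitian :=
    fun t ht => isHermitian_extend_sub (hΦ t ht) isChannel_id hpsd
  rw [hsplit, expect_eq_smul_sum, extend_smul, extend_sum, Finset.expect_eq_sum_div_card,
    div_eq_inv_mul]
  have hcard : (0 : ℝ) ≤ (s.card : ℝ)⁻¹ := inv_nonneg.mpr (Nat.cast_nonneg _)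
  refine (traceNorm_smul_le (isSelfAdjoint_sum s hH) hcard).trans
    (mul_le_mul_of_nonneg_left ?_ hcard)
  exact (traceNorm_sum_le s hH).trans (Finset.sum_le_sum fun t ht => hc t ht κ ψ hψ)

end Channels

/-! ### The bound for arbitrary noise -/

namespace Circuit

variable {d n K : ℕ} (Q : Circuit d n K)

theorem twirlAt_nonempty (k : Fin (K + 1)) : (Q.twirlAt k).Nonempty := by
  rcases Q.twirlAt_eq k with h | ⟨-, h⟩
  · exact h ▸ Q.twirl_nonempty
  · exact h ▸ Finset.singleton_nonempty 1

theorem twirlPairs_nonempty (k : Fin K) : (Q.twirlPairs k).Nonempty :=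
  (Fintype.piFinset_nonempty.mpr fun _ => Q.twirlAt_nonempty _).product
    (Fintype.piFinset_nonempty.mpr fun _ => Q.twirlAt_nonempty _)

theorem expect_diamondNorm_sub_averagedNoise_le
    (E : (Fin n → Q.easy) → SuperOp (Qudits n d)) (hE : ∀ C, IsChannel (E C)) (k : Fin K) :
    𝔼 T ∈ Q.twirlPairs k, diamondNorm (E (Q.dressed k T) - Q.averagedNoise k E) ≤
      2 * worstCaseError (Q.averagedNoise k E) +
        2 * Real.sqrt (𝔼 T ∈ Q.twirlPairs k, worstCaseError (E (Q.dressed k T)) ^ 2) := by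
  have hne := Q.twirlPairs_nonempty k
  have havg : IsChannel (Q.averagedNoise k E) := IsChannel.expect hne fun _ _ => hE _
  calc 𝔼 T ∈ Q.twirlPairs k, diamondNorm (E (Q.dressed k T) - Q.averagedNoise k E)
      ≤ 𝔼 T ∈ Q.twirlPairs k, (2 * worstCaseError (E (Q.dressed k T)) +
          2 * worstCaseError (Q.averagedNoise k E)) :=
        Finset.expect_le_expect fun T _ => diamondNorm_sub_le_worstCaseError (hE _) havg
    _ = 2 * worstCaseError (Q.averagedNoise k E) +
          2 * 𝔼 T ∈ Q.twirlPairs k, worstCaseError (E (Q.dressed k T)) := by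
        rw [Finset.expect_add_distrib, Finset.expect_const hne, ← Finset.mul_expect, add_comm]
    _ ≤ _ := by
        have := expect_le_sqrt_expect_sq (Q.twirlPairs k)
          fun T => worstCaseError (E (Q.dressed k T))
        linarith

end Circuit

/-! ### Tensor products of single-qudit channels -/

section Local

variable {n d : ℕ}

/-- The superoperator that acts as `Φ` on the `j`-th qudit and trivially on all others. -/
def onSite (j : Fin n) (Φ : SuperOp (Fin d)) : SuperOp (Qudits n d) where
  toFun Y := Matrix.of fun p q =>
    Φ (Matrix.of fun x y => Y (Function.update p j x) (Function.update q j y)) (p j) (q j)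
  map_add' X Y := by
    ext p q
    exact congrFun (congrFun (map_add Φ
      (Matrix.of fun x y => X (Function.update p j x) (Function.update q j y))
      (Matrix.of fun x y => Y (Function.update p j x) (Function.update q j y))) (p j)) (q j)
  map_smul' c X := by
    ext p q
    exact congrFun (congrFun (map_smul Φ c
      (Matrix.of fun x y => X (Function.update p j x) (Function.update q j y))) (p j)) (q j)

theorem onSite_tensorMatrix (j : Fin n) (Φ : SuperOp (Fin d))
    (A : Fin n → Matrix (Fin d) (Fin d) ℂ) :
    onSite j Φ (tensorMatrix A) = tensorMatrix (Function.update A j (Φ (A j))) := by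
  ext p q
  have hcoef : (Matrix.of fun x y =>
      tensorMatrix A (Function.update p j x) (Function.update q j y)) =
      (∏ i ∈ Finset.univ.erase j, A i (p i) (q i)) • A j := by
    ext x y
    simp only [tensorMatrix, Matrix.of_apply, Matrix.smul_apply, smul_eq_mul]
    rw [← Finset.prod_erase_mul _ _ (Finset.mem_univ j), Function.update_self,
      Function.update_self]
    congr 1
    refine Finset.prod_congr rfl fun i hi => ?_
    rw [Function.update_of_ne (Finset.ne_of_mem_erase hi),
      Function.update_of_ne (Finset.ne_of_mem_erase hi)]
  change Φ (Matrix.of fun x y =>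
      tensorMatrix A (Function.update p j x) (Function.update q j y)) (p j) (q j) =
    ∏ i, Function.update A j (Φ (A j)) i (p i) (q i)
  rw [hcoef, map_smul, Matrix.smul_apply, smul_eq_mul,
    ← Finset.prod_erase_mul _ _ (Finset.mem_univ j), Function.update_self]
  congr 1
  refine Finset.prod_congr rfl fun i hi => ?_
  rw [Function.update_of_ne (Finset.ne_of_mem_erase hi)]

/-- Builds a tensor product one site at a time, so that the composition lemma applies. -/
theorem tensorSuperOp_update (Φ : Fin n → SuperOp (Fin d)) (j : Fin n) (Ψ : SuperOp (Fin d))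
    (hj : Φ j = LinearMap.id) :
    tensorSuperOp (Function.update Φ j Ψ) = onSite j Ψ ∘ₗ tensorSuperOp Φ := by
  refine LinearMap.ext fun X => ?_
  change ∑ a : Qudits n d, ∑ b : Qudits n d, X a b • tensorMatrix (fun i =>
      Function.update Φ j Ψ i (Matrix.single (a i) (b i) 1)) =
    onSite j Ψ (∑ a : Qudits n d, ∑ b : Qudits n d, X a b • tensorMatrix (fun i =>
      Φ i (Matrix.single (a i) (b i) 1)))
  simp only [map_sum, map_smul, onSite_tensorMatrix, hj, LinearMap.id_apply]
  refine Finset.sum_congr rfl fun a _ => Finset.sum_congr rfl fun b _ => ?_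
  congr 2
  funext i
  rcases eq_or_ne i j with rfl | h
  · simp
  · simp [Function.update_of_ne h]

theorem tensorSuperOp_id :
    tensorSuperOp (fun _ : Fin n => (LinearMap.id : SuperOp (Fin d))) = LinearMap.id := by
  refine LinearMap.ext fun X => ?_
  have hunit (a b : Qudits n d) : tensorMatrix (fun i => Matrix.single (a i) (b i) (1 : ℂ)) =
      Matrix.single a b 1 := by
    ext p q
    simp only [tensorMatrix, Matrix.of_apply, Matrix.single_apply, Finset.prod_ite_zero,
      Finset.prod_const_one, Finset.mem_univ, true_imp_iff, forall_and, funext_iff]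
  change ∑ a : Qudits n d, ∑ b : Qudits n d, X a b • tensorMatrix (fun i =>
      Matrix.single (a i) (b i) 1) = X
  simp only [hunit, Matrix.smul_single, smul_eq_mul, mul_one]
  exact (Matrix.matrix_eq_sum_single X).symm

/-- Regroups a register of `n` qudits and an ancilla as the `j`-th qudit and a larger ancilla. -/
def siteEquiv (j : Fin n) (d : ℕ) (κ : Type*) :
    Qudits n d × κ ≃ Fin d × (({i // i ≠ j} → Fin d) × κ) :=
  ((Equiv.funSplitAt j (Fin d)).prodCongr (Equiv.refl κ)).trans (Equiv.prodAssoc _ _ _)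

theorem extend_onSite (j : Fin n) (Φ : SuperOp (Fin d)) {κ : Type*}
    (X : Matrix (Qudits n d × κ) (Qudits n d × κ) ℂ) :
    extend (onSite j Φ) κ X = (extend Φ (({i // i ≠ j} → Fin d) × κ)
      (X.submatrix (siteEquiv j d κ).symm (siteEquiv j d κ).symm)).submatrix
        (siteEquiv j d κ) (siteEquiv j d κ) := by
  ext p q
  rfl

theorem isChannel_onSite (j : Fin n) {Φ : SuperOp (Fin d)} (hΦ : IsChannel Φ) :
    IsChannel (onSite j Φ) := by
  refine ⟨fun m X hX => ?_, fun X => ?_⟩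
  · rw [extend_onSite]
    exact (posSemidef_extend hΦ (hX.submatrix _)).submatrix _
  -- A trivial ancilla is attached so that the regrouping formula also gives trace preservation.
  · have htr (Y : SuperOp (Qudits n d)) : (Y X).trace =
        (extend Y Unit (Matrix.of fun a b => X a.1 b.1)).trace := by
      simp only [Matrix.trace, Matrix.diag_apply, Fintype.sum_prod_type_right]
      simp [extend]
      rfl
    have htr' {α β : Type} [Fintype α] [Fintype β] (e : α ≃ β) (Y : Matrix β β ℂ) :
        (Y.submatrix e e).trace = Y.trace := e.sum_comp fun i => Y i i
    rw [htr, extend_onSite, htr', trace_extend hΦ, htr']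
    simp [Matrix.trace, Fintype.sum_prod_type_right]

/-- The other qudits join the ancilla. This is why the bound has to hold for ancillas of every size,
not only the dimension of the system. -/
theorem StableBound.onSite (j : Fin n) {Φ : SuperOp (Fin d)} (hΦ : IsChannel Φ) {c : ℝ}
    (h : StableBound (Φ - LinearMap.id) c) :
    StableBound (onSite j Φ - LinearMap.id) c := by
  intro κ _ _ ψ hψ
  set e := siteEquiv j d κ
  let φ : EuclideanSpace ℂ (Fin d × (({i // i ≠ j} → Fin d) × κ)) :=
    LinearIsometryEquiv.piLpCongrLeft 2 ℂ ℂ e ψ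
  have hφ : ‖φ‖ = 1 := by rw [LinearIsometryEquiv.norm_map, hψ]
  have hket : (ketBra ψ).submatrix e.symm e.symm = ketBra φ := by
    ext a b
    rfl
  have hkey : extend (RandomizedCompiling.onSite j Φ - LinearMap.id) κ (ketBra ψ) =
      (extend (Φ - LinearMap.id) _ (ketBra φ)).submatrix e e := by
    rw [extend_sub, extend_sub, extend_onSite, hket, extend_id, extend_id, ← hket]
    ext a b
    simp [e]
  rw [hkey]
  exact (traceNorm_submatrix_le (isHermitian_extend_sub hΦ isChannel_id
    (posSemidef_ketBra φ)) e).trans (h _ φ hφ)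

theorem isChannel_tensorSuperOp_and_stableBound {Φ : Fin n → SuperOp (Fin d)}
    (hΦ : ∀ j, IsChannel (Φ j)) {c : Fin n → ℝ}
    (hc : ∀ j, StableBound (Φ j - LinearMap.id) (c j)) :
    IsChannel (tensorSuperOp Φ) ∧ StableBound (tensorSuperOp Φ - LinearMap.id) (∑ j, c j) := by
  -- Induction on the set of sites where the noise is switched on; all other factors are the
  -- identity.
  suffices h : ∀ S : Finset (Fin n),
      IsChannel (tensorSuperOp fun j => if j ∈ S then Φ j else LinearMap.id) ∧
      StableBound ((tensorSuperOp fun j => if j ∈ S then Φ j else LinearMap.id) - LinearMap.id)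
        (∑ j ∈ S, c j) by
    simpa using h Finset.univ
  intro S
  induction S using Finset.induction_on with
  | empty =>
    simp only [Finset.notMem_empty, if_false, tensorSuperOp_id, Finset.sum_empty]
    exact ⟨isChannel_id, stableBound_id_sub_id⟩
  | insert a S ha ih =>
    have hfun : (fun j => if j ∈ insert a S then Φ j else LinearMap.id) =
        Function.update (fun j => if j ∈ S then Φ j else LinearMap.id) a (Φ a) := by
      funext j
      rcases eq_or_ne j a with rfl | h
      · simp
      · simp [h]
    rw [hfun, tensorSuperOp_update _ _ _ (if_neg ha), Finset.sum_insert ha]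
    exact ⟨(isChannel_onSite a (hΦ a)).comp ih.1,
      StableBound.comp (isChannel_onSite a (hΦ a)) ih.1 ((hc a).onSite a (hΦ a)) ih.2⟩

end Local

/-! ### Overlaps of pure states and the Fuchs–van de Graaf inequality -/

section PureStates

variable {ι κ : Type*} [Fintype ι] [DecidableEq ι] [Fintype κ] [DecidableEq κ]

omit [DecidableEq ι] in
theorem ketBra_mul_ketBra_self (ψ : EuclideanSpace ℂ ι) :
    ketBra ψ * ketBra ψ = (‖ψ‖ ^ 2) • ketBra ψ := by
  have h := trace_ketBra ψ
  ext i j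
  rw [Matrix.mul_apply, Matrix.smul_apply, Complex.real_smul, ← h, Matrix.trace, Finset.sum_mul]
  refine Finset.sum_congr rfl fun k _ => ?_
  simp only [ketBra, Matrix.diag_apply, Matrix.of_apply]
  ring

omit [DecidableEq ι] in
theorem rank_ketBra_sub_ketBra_le (u w : EuclideanSpace ℂ ι) : (ketBra u - ketBra w).rank ≤ 2 := by
  have h : ketBra u - ketBra w = (Matrix.of fun i => ![u i, -w i] : Matrix ι (Fin 2) ℂ) *
      (Matrix.of ![fun j => star (u j), fun j => star (w j)] : Matrix (Fin 2) ι ℂ) := by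
    ext i j
    simp [Matrix.mul_apply, ketBra, sub_eq_add_neg]
  rw [h]
  exact (rank_mul_le_left _ _).trans ((rank_le_card_width _).trans_eq (Fintype.card_fin 2))

omit [DecidableEq ι] in
theorem trace_sq_ketBra_sub_ketBra {u w : EuclideanSpace ℂ ι} {t : ℝ} (hu : ‖u‖ ^ 2 = t)
    (hw : ‖w‖ ^ 2 = t) :
    ((ketBra u - ketBra w).conjTranspose * (ketBra u - ketBra w)).trace.re =
      2 * (t ^ 2 - (ketBra u * ketBra w).trace.re) := by
  rw [((posSemidef_ketBra u).isHermitian.sub (posSemidef_ketBra w).isHermitian).eq,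
    Matrix.sub_mul, Matrix.mul_sub, Matrix.mul_sub, ketBra_mul_ketBra_self,
    ketBra_mul_ketBra_self, trace_sub, trace_sub, trace_sub, Matrix.trace_mul_comm (ketBra w),
    trace_smul, trace_smul, trace_ketBra, trace_ketBra, hu, hw]
  simp only [Complex.sub_re, Complex.smul_re, Complex.ofReal_re, smul_eq_mul]
  ring

omit [DecidableEq ι] in
theorem trace_ketBra_mul_ketBra_le {u w : EuclideanSpace ℂ ι} {t : ℝ} (hu : ‖u‖ ^ 2 = t)
    (hw : ‖w‖ ^ 2 = t) : (ketBra u * ketBra w).trace.re ≤ t ^ 2 := by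
  have h := (Complex.le_def.mp
    (posSemidef_conjTranspose_mul_self (ketBra u - ketBra w)).trace_nonneg).1
  rw [trace_sq_ketBra_sub_ketBra hu hw, Complex.zero_re] at h
  linarith

/-- The difference has rank at most 2 and squared Hilbert–Schmidt norm 2(t² - overlap); the rank
bound multiplies these under the root. -/
theorem traceNorm_ketBra_sub_ketBra_le {u w : EuclideanSpace ℂ ι} {t : ℝ} (hu : ‖u‖ ^ 2 = t)
    (hw : ‖w‖ ^ 2 = t) :
    traceNorm (ketBra u - ketBra w) ≤
      2 * Real.sqrt (t ^ 2 - (ketBra u * ketBra w).trace.re) := by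
  have hnn := sub_nonneg.mpr (trace_ketBra_mul_ketBra_le hu hw)
  have hrank : ((ketBra u - ketBra w).rank : ℝ) ≤ 2 := by
    exact_mod_cast rank_ketBra_sub_ketBra_le u w
  refine (traceNorm_le_sqrt_rank_mul _).trans ?_
  rw [trace_sq_ketBra_sub_ketBra hu hw, show (2 : ℝ) = Real.sqrt (2 * 2) by simp,
    ← Real.sqrt_mul (by norm_num)]
  apply Real.sqrt_le_sqrt
  rw [Real.sqrt_mul_self (by norm_num)]
  nlinarith

theorem eq_sum_smul_ketBra {ρ : Matrix ι ι ℂ} (hρ : ρ.IsHermitian) :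
    ρ = ∑ i, hρ.eigenvalues i • ketBra (hρ.eigenvectorBasis i) := by
  conv_lhs => rw [hρ.spectral_theorem, Unitary.conjStarAlgAut_apply]
  ext a b
  rw [Matrix.sum_apply, Matrix.mul_apply]
  refine Finset.sum_congr rfl fun i _ => ?_
  rw [Matrix.mul_diagonal, Matrix.smul_apply, Complex.real_smul]
  simp only [ketBra, Matrix.of_apply, Matrix.star_apply, Function.comp_apply,
    IsHermitian.eigenvectorUnitary_apply]
  change _ * ((hρ.eigenvalues i : ℝ) : ℂ) * _ = _
  ring

/-- Eigenvectors are rescaled to squared norm t and eigenvalues divided by t, giving a convex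
combination of vectors as long as the reference vector. -/
theorem exists_mixture_of_posSemidef {ρ : Matrix ι ι ℂ} (hρ : ρ.PosSemidef) {t : ℝ} (ht : 0 < t)
    (htr : ρ.trace.re = t) :
    ∃ (p : ι → ℝ) (u : ι → EuclideanSpace ℂ ι), (∀ i, 0 ≤ p i) ∧ ∑ i, p i = 1 ∧
      (∀ i, ‖u i‖ ^ 2 = t) ∧ ρ = ∑ i, p i • ketBra (u i) := by
  set l := hρ.isHermitian.eigenvalues
  set v := hρ.isHermitian.eigenvectorBasis
  have hket (i : ι) : ketBra (((Real.sqrt t : ℝ) : ℂ) • v i) = t • ketBra (v i) := by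
    ext a b
    simp only [ketBra, Matrix.of_apply, Matrix.smul_apply, Complex.real_smul,
      PiLp.smul_apply, smul_eq_mul, star_mul', Complex.star_def, Complex.conj_ofReal]
    rw [mul_mul_mul_comm, ← Complex.ofReal_mul, Real.mul_self_sqrt ht.le]
  refine ⟨fun i => l i / t, fun i => ((Real.sqrt t : ℝ) : ℂ) • v i,
    fun i => div_nonneg (hρ.eigenvalues_nonneg i) ht.le, ?_, fun i => ?_, ?_⟩
  · rw [← Finset.sum_div, div_eq_one_iff_eq ht.ne', ← htr,
      hρ.isHermitian.trace_eq_sum_eigenvalues, Complex.re_sum]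
    rfl
  · rw [norm_smul, v.norm_eq_one, mul_one, Complex.norm_real, Real.norm_eq_abs, sq_abs,
      Real.sq_sqrt ht.le]
  · simp only [hket, smul_smul, div_mul_cancel₀ _ ht.ne']
    exact eq_sum_smul_ketBra hρ.isHermitian

omit [DecidableEq ι] in
theorem sub_trace_mul_ketBra_eq_sum (t : ℝ) {p : ι → ℝ} (hp : ∑ i, p i = 1)
    (u : ι → EuclideanSpace ℂ ι) (φ : EuclideanSpace ℂ ι) :
    t ^ 2 - ((∑ i, p i • ketBra (u i)) * ketBra φ).trace.re =
      ∑ i, p i * (t ^ 2 - (ketBra (u i) * ketBra φ).trace.re) := by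
  simp only [mul_sub, Finset.sum_sub_distrib, ← Finset.sum_mul, hp, one_mul]
  congr 1
  rw [Finset.sum_mul, trace_sum, Complex.re_sum]
  exact Finset.sum_congr rfl fun i _ => by
    rw [Matrix.smul_mul, trace_smul, Complex.smul_re, smul_eq_mul]

theorem trace_mul_ketBra_le {ρ : Matrix ι ι ℂ} (hρ : ρ.PosSemidef) {φ : EuclideanSpace ℂ ι}
    {t : ℝ} (ht : 0 < t) (htr : ρ.trace.re = t) (hφ : ‖φ‖ ^ 2 = t) :
    (ρ * ketBra φ).trace.re ≤ t ^ 2 := by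
  obtain ⟨p, u, hpnn, hp, hu, rfl⟩ := exists_mixture_of_posSemidef hρ ht htr
  rw [← sub_nonneg, sub_trace_mul_ketBra_eq_sum t hp]
  exact Finset.sum_nonneg fun i _ => mul_nonneg (hpnn i)
    (sub_nonneg.mpr (trace_ketBra_mul_ketBra_le (hu i) hφ))

/-- The upper Fuchs–van de Graaf inequality against a pure state, without normalization. -/
theorem traceNorm_sub_ketBra_le {ρ : Matrix ι ι ℂ} (hρ : ρ.PosSemidef) {φ : EuclideanSpace ℂ ι}
    {t : ℝ} (ht : 0 < t) (htr : ρ.trace.re = t) (hφ : ‖φ‖ ^ 2 = t) :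
    traceNorm (ρ - ketBra φ) ≤ 2 * Real.sqrt (t ^ 2 - (ρ * ketBra φ).trace.re) := by
  obtain ⟨p, u, hpnn, hp, hu, rfl⟩ := exists_mixture_of_posSemidef hρ ht htr
  have hsplit : (∑ i, p i • ketBra (u i)) - ketBra φ = ∑ i, p i • (ketBra (u i) - ketBra φ) := by
    simp only [smul_sub, Finset.sum_sub_distrib, ← Finset.sum_smul, hp, one_smul]
  have hH (i : ι) : (ketBra (u i) - ketBra φ).IsHermitian :=
    (posSemidef_ketBra (u i)).isHermitian.sub (posSemidef_ketBra φ).isHermitian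
  calc traceNorm ((∑ i, p i • ketBra (u i)) - ketBra φ)
      ≤ ∑ i, traceNorm (p i • (ketBra (u i) - ketBra φ)) := by
        rw [hsplit]
        exact traceNorm_sum_le _ fun i _ => IsSelfAdjoint.smul (IsSelfAdjoint.all _) (hH i)
    _ ≤ ∑ i, p i * (2 * Real.sqrt (t ^ 2 - (ketBra (u i) * ketBra φ).trace.re)) :=
        Finset.sum_le_sum fun i _ => (traceNorm_smul_le (hH i) (hpnn i)).trans
          (mul_le_mul_of_nonneg_left (traceNorm_ketBra_sub_ketBra_le (hu i) hφ) (hpnn i))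
    _ = 2 * ∑ i, p i • Real.sqrt (t ^ 2 - (ketBra (u i) * ketBra φ).trace.re) := by
        rw [Finset.mul_sum]
        exact Finset.sum_congr rfl fun i _ => by rw [smul_eq_mul]; ring
    _ ≤ 2 * Real.sqrt (t ^ 2 - ((∑ i, p i • ketBra (u i)) * ketBra φ).trace.re) := by
        rw [sub_trace_mul_ketBra_eq_sum t hp]
        refine mul_le_mul_of_nonneg_left ?_ (by norm_num)
        -- Jensen for the square root, on arguments that are nonnegative by the overlap bound.
        exact Real.strictConcaveOn_sqrt.concaveOn.le_map_sum (fun i _ => hpnn i) hp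
          fun i _ => Set.mem_Ici.mpr (sub_nonneg.mpr (trace_ketBra_mul_ketBra_le (hu i) hφ))

end PureStates

/-! ### Reduction to the Choi matrix -/

section Choi

variable {ι κ : Type*} [Fintype ι] [DecidableEq ι] [Fintype κ] [DecidableEq κ]

/-- The unnormalized maximally entangled state `∑ᵢ |i⟩|i⟩`. -/
def maxEntangled (ι : Type*) [Fintype ι] [DecidableEq ι] : EuclideanSpace ℂ (ι × ι) :=
  WithLp.toLp 2 fun p => if p.1 = p.2 then 1 else 0

theorem norm_sq_maxEntangled : ‖maxEntangled ι‖ ^ 2 = Fintype.card ι := by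
  rw [EuclideanSpace.norm_sq_eq, Fintype.sum_prod_type]
  simp [maxEntangled, apply_ite norm, ite_pow]

/-- The operator on the ancilla that steers the maximally entangled state to `ψ`. -/
def steering (ψ : EuclideanSpace ℂ (ι × κ)) : Matrix (ι × κ) (ι × ι) ℂ :=
  Matrix.of fun p q => if p.1 = q.1 then ψ (q.2, p.2) else 0

theorem extend_ketBra_maxEntangled_apply (Φ : SuperOp ι) (p q : ι × ι) :
    extend Φ ι (ketBra (maxEntangled ι)) p q = Φ (Matrix.single p.2 q.2 1) p.1 q.1 := by
  simp only [extend, Matrix.of_apply]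
  refine congrFun (congrFun (congrArg Φ ?_) _) _
  ext i j
  simp only [ketBra, maxEntangled, Matrix.of_apply, Matrix.single_apply]
  split_ifs <;> simp_all

omit [Fintype κ] [DecidableEq κ] in
-- Every ψ is the image of the maximally entangled vector under an operator on the ancilla alone,
-- and such operators commute with Φ ⊗ id.
theorem extend_ketBra_eq_steering (Φ : SuperOp ι) (ψ : EuclideanSpace ℂ (ι × κ)) :
    extend Φ κ (ketBra ψ) = steering ψ * extend Φ ι (ketBra (maxEntangled ι)) *
      (steering ψ).conjTranspose := by
  ext ⟨i, k⟩ ⟨i', k'⟩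
  have hX : (Matrix.of fun a b => ketBra ψ (a, k) (b, k')) =
      ∑ a, ∑ b, (ψ (a, k) * star (ψ (b, k'))) • Matrix.single a b (1 : ℂ) := by
    simp only [Matrix.smul_single, smul_eq_mul, mul_one]
    exact Matrix.matrix_eq_sum_single _
  change Φ (Matrix.of fun a b => ketBra ψ (a, k) (b, k')) i i' = _
  rw [hX]
  simp only [map_sum, map_smul, Matrix.sum_apply, Matrix.smul_apply, smul_eq_mul,
    Matrix.mul_apply, Matrix.conjTranspose_apply, extend_ketBra_maxEntangled_apply,
    Fintype.sum_prod_type, steering, Matrix.of_apply, ite_mul, zero_mul, apply_ite star, star_zero,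
    mul_ite, mul_zero, Finset.sum_ite_irrel, Finset.sum_const_zero, Finset.sum_ite_eq,
    Finset.mem_univ, if_true, Finset.sum_mul]
  rw [Finset.sum_comm]
  exact Finset.sum_congr rfl fun b _ => Finset.sum_congr rfl fun a _ => by ring

omit [DecidableEq ι] [DecidableEq κ] in
theorem trace_mul_conjTranspose_self_re (M : Matrix ι κ ℂ) :
    (M * M.conjTranspose).trace.re = ∑ a, ∑ b, ‖M a b‖ ^ 2 := by
  simp only [Matrix.trace, Matrix.diag_apply, Matrix.mul_apply, Matrix.conjTranspose_apply,
    Complex.star_def, Complex.mul_conj, Complex.re_sum, Complex.ofReal_re,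
    Complex.normSq_eq_norm_sq]

omit [DecidableEq κ] in
open scoped MatrixOrder Matrix.Norms.L2Operator in
-- The steering operator has Hilbert–Schmidt norm ‖ψ‖ = 1 on the ancilla, hence is a contraction.
-- Concretely, write P = C†C and apply Cauchy–Schwarz to each entry.
theorem trace_steering_conj_le {P : Matrix (ι × ι) (ι × ι) ℂ} (hP : P.PosSemidef)
    {ψ : EuclideanSpace ℂ (ι × κ)} (hψ : ‖ψ‖ = 1) :
    (steering ψ * P * (steering ψ).conjTranspose).trace.re ≤ P.trace.re := by
  obtain ⟨C, rfl⟩ := CStarAlgebra.nonneg_iff_eq_star_mul_self.mp hP.nonneg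
  have hψ' : ∑ k, ∑ j, ‖ψ (j, k)‖ ^ 2 = 1 := by
    rw [← Fintype.sum_prod_type_right (f := fun p : ι × κ => ‖ψ p‖ ^ 2),
      ← EuclideanSpace.norm_sq_eq, hψ, one_pow]
  rw [Matrix.star_eq_conjTranspose, Matrix.trace_mul_comm C.conjTranspose C, trace_mul_conjTranspose_self_re,
    show steering ψ * (C.conjTranspose * C) * (steering ψ).conjTranspose =
      (steering ψ * C.conjTranspose) * (steering ψ * C.conjTranspose).conjTranspose by
      rw [conjTranspose_mul, conjTranspose_conjTranspose]; simp only [Matrix.mul_assoc], trace_mul_conjTranspose_self_re,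
    Finset.sum_comm]
  refine Finset.sum_le_sum fun r _ => ?_
  rw [Fintype.sum_prod_type, Fintype.sum_prod_type]
  refine Finset.sum_le_sum fun i _ => ?_
  have hentry (k : κ) : (steering ψ * C.conjTranspose) (i, k) r =
      ∑ j, ψ (j, k) * star (C r (i, j)) := by
    simp only [Matrix.mul_apply, Fintype.sum_prod_type, steering, Matrix.of_apply,
      Matrix.conjTranspose_apply, ite_mul, zero_mul, Finset.sum_ite_irrel, Finset.sum_const_zero,
      Finset.sum_ite_eq, Finset.mem_univ, if_true]
  calc ∑ k, ‖(steering ψ * C.conjTranspose) (i, k) r‖ ^ 2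
      ≤ ∑ k, (∑ j, ‖ψ (j, k)‖ ^ 2) * ∑ j, ‖C r (i, j)‖ ^ 2 := by
        refine Finset.sum_le_sum fun k _ => ?_
        rw [hentry]
        refine (pow_le_pow_left₀ (norm_nonneg _) (norm_sum_le _ _) 2).trans ?_
        simp only [norm_mul, norm_star]
        exact Finset.sum_mul_sq_le_sq_mul_sq _ _ _
    _ = ∑ j, ‖C r (i, j)‖ ^ 2 := by rw [← Finset.sum_mul, hψ', one_mul]

theorem traceNorm_extend_ketBra_le_choi {Φ : SuperOp ι}
    (hH : (extend Φ ι (ketBra (maxEntangled ι))).IsHermitian) {ψ : EuclideanSpace ℂ (ι × κ)}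
    (hψ : ‖ψ‖ = 1) :
    traceNorm (extend Φ κ (ketBra ψ)) ≤ traceNorm (extend Φ ι (ketBra (maxEntangled ι))) := by
  obtain ⟨P, N, hP, hN, hPN, h⟩ := exists_posSemidef_sub_eq hH
  rw [← h, extend_ketBra_eq_steering, hPN, Matrix.mul_sub, Matrix.sub_mul]
  exact (traceNorm_sub_le_trace_add_trace (hP.mul_mul_conjTranspose_same _)
    (hN.mul_mul_conjTranspose_same _)).trans
      (add_le_add (trace_steering_conj_le hP hψ) (trace_steering_conj_le hN hψ))

/-- Both sides are d² times the entanglement fidelity of Φ. -/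
theorem trace_choi_mul_maxEntangled (Φ : SuperOp ι) :
    (extend Φ ι (ketBra (maxEntangled ι)) * ketBra (maxEntangled ι)).trace =
      ∑ i, ∑ j, Φ (Matrix.single i j 1) i j := by
  simp only [← extend_ketBra_maxEntangled_apply Φ (_, _) (_, _)]
  generalize extend Φ ι (ketBra (maxEntangled ι)) = J
  simp only [Matrix.trace, Matrix.diag_apply, Matrix.mul_apply, Fintype.sum_prod_type, ketBra,
    maxEntangled, Matrix.of_apply, apply_ite star, star_one, star_zero, mul_ite, mul_one, mul_zero]
  simp

theorem sum_apply_single_le [Nonempty ι] {Φ : SuperOp ι} (hΦ : IsChannel Φ) :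
    (∑ i, ∑ j, Φ (Matrix.single i j 1) i j).re ≤ (Fintype.card ι : ℝ) ^ 2 := by
  have hpsd := posSemidef_ketBra (maxEntangled ι)
  rw [← trace_choi_mul_maxEntangled]
  refine trace_mul_ketBra_le (posSemidef_extend hΦ hpsd)
    (Nat.cast_pos.mpr Fintype.card_pos) ?_ norm_sq_maxEntangled
  rw [trace_extend hΦ, trace_ketBra, norm_sq_maxEntangled, Complex.ofReal_re]

theorem stableBound_sub_id [Nonempty ι] {Φ : SuperOp ι} (hΦ : IsChannel Φ) :
    StableBound (Φ - LinearMap.id) (2 * Real.sqrt ((Fintype.card ι : ℝ) ^ 2 -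
      (∑ i, ∑ j, Φ (Matrix.single i j 1) i j).re)) := by
  intro κ _ _ ψ hψ
  have hpsd := posSemidef_ketBra (maxEntangled ι)
  refine (traceNorm_extend_ketBra_le_choi
    (isHermitian_extend_sub hΦ isChannel_id hpsd) hψ).trans ?_
  rw [← trace_choi_mul_maxEntangled]
  refine traceNorm_sub_ketBra_le (posSemidef_extend hΦ hpsd)
    (Nat.cast_pos.mpr Fintype.card_pos) ?_ norm_sq_maxEntangled
  rw [trace_extend hΦ, trace_ketBra, norm_sq_maxEntangled, Complex.ofReal_re]

end Choi

/-! ### Isometry invariance of the surface measure -/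

section SphereInvariance

open scoped Pointwise

variable {E : Type*} [NormedAddCommGroup E] [InnerProductSpace ℝ E] [FiniteDimensional ℝ E]
  [MeasurableSpace E] [BorelSpace E]

/-- The surface measure of a set is, up to the dimension factor, the volume of the cone over it. A
linear isometry maps cones to cones and preserves volume. -/
theorem measurePreserving_toSphere (L : E ≃ₗᵢ[ℝ] E) :
    MeasurePreserving
      (fun x : Metric.sphere (0 : E) 1 =>
        (⟨L x, by simp [mem_sphere_zero_iff_norm.mp x.2]⟩ : Metric.sphere (0 : E) 1))
      (volume : Measure E).toSphere (volume : Measure E).toSphere := by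
  have hcont : Continuous (fun x : Metric.sphere (0 : E) 1 =>
      (⟨L x, by simp [mem_sphere_zero_iff_norm.mp x.2]⟩ : Metric.sphere (0 : E) 1)) :=
    (L.continuous.comp continuous_subtype_val).subtype_mk _
  refine ⟨hcont.measurable, Measure.ext fun s hs => ?_⟩
  rw [Measure.map_apply hcont.measurable hs, Measure.toSphere_apply' _ hs,
    Measure.toSphere_apply' _ (hcont.measurable hs),
    ← L.measurePreserving.measure_preimage_emb L.toHomeomorph.measurableEmbedding
      (Set.Ioo (0 : ℝ) 1 • ((Subtype.val '' s : Set E)))]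
  congr 2
  ext x
  simp only [Set.mem_smul, Set.mem_image, Set.mem_preimage, Subtype.exists, exists_and_right,
    exists_eq_right]
  constructor
  · rintro ⟨r, hr, y, ⟨hy, hys⟩, rfl⟩
    exact ⟨r, hr, L y, ⟨by simp [mem_sphere_zero_iff_norm.mp hy], hys⟩, (map_smul L r y).symm⟩
  · rintro ⟨r, hr, y, ⟨hy, hys⟩, hxy⟩
    refine ⟨r, hr, L.symm y, ⟨by simp [mem_sphere_zero_iff_norm.mp hy], ?_⟩, ?_⟩
    · simpa using hys
    · rw [← map_smul, hxy, L.symm_apply_apply]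

theorem integral_toSphere_comp (L : E →ₗᵢ[ℝ] E) {g : E → ℂ} (hg : Continuous g) :
    ∫ x : Metric.sphere (0 : E) 1, g (L x) ∂(volume : Measure E).toSphere =
      ∫ x : Metric.sphere (0 : E) 1, g x ∂(volume : Measure E).toSphere := by
  have h := measurePreserving_toSphere (L.toLinearIsometryEquiv rfl)
  have hg' : Continuous fun x : Metric.sphere (0 : E) 1 => g x := hg.comp continuous_subtype_val
  conv_rhs => rw [← h.map_eq, integral_map h.measurable.aemeasurable
    hg'.aestronglyMeasurable]
  rfl

theorem integrable_toSphere {g : E → ℂ} (hg : Continuous g) :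
    Integrable (fun x : Metric.sphere (0 : E) 1 => g x) (volume : Measure E).toSphere :=
  (hg.comp continuous_subtype_val).integrable_of_hasCompactSupport
    (HasCompactSupport.of_compactSpace _)

end SphereInvariance

/-! ### Fourth moments of the uniform measure on qubit states -/

section QubitMoments

/-- The space of state vectors of a qubit. -/
abbrev QubitSpace : Type := EuclideanSpace ℂ (Fin 2)

/-- The quartic monomial whose integrals are the fourth moments of the uniform measure. -/
def quartic (a b c e : Fin 2) (x : QubitSpace) : ℂ := star (x a) * star (x b) * x c * x e

theorem continuous_quartic (a b c e : Fin 2) : Continuous (quartic a b c e) := by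
  unfold quartic
  fun_prop

/-- The fourth moments of the surface measure of the sphere of pure qubit states. -/
def moment (a b c e : Fin 2) : ℂ :=
  ∫ x : Metric.sphere (0 : QubitSpace) 1, quartic a b c e x ∂(volume : Measure QubitSpace).toSphere

/-- The phase gate. -/
def phaseGate : QubitSpace →ₗᵢ[ℝ] QubitSpace where
  toFun x := !₂[x 0, Complex.I * x 1]
  map_add' x y := by ext i; fin_cases i <;> simp [mul_add]
  map_smul' c x := by ext i; fin_cases i <;> simp [mul_left_comm]
  norm_map' x := by simp [EuclideanSpace.norm_eq, Fin.sum_univ_two]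

/-- The Hadamard gate. -/
def hadamardGate : QubitSpace →ₗᵢ[ℝ] QubitSpace where
  toFun x := !₂[((Real.sqrt 2)⁻¹ : ℝ) * (x 0 + x 1), ((Real.sqrt 2)⁻¹ : ℝ) * (x 0 - x 1)]
  map_add' x y := by ext i; fin_cases i <;> simp <;> ring
  map_smul' c x := by ext i; fin_cases i <;> simp <;> ring
  norm_map' x := by
    have h := parallelogram_law_with_norm ℝ (x 0) (x 1)
    simp only [EuclideanSpace.norm_eq, Fin.sum_univ_two]
    congr 1
    simp [mul_pow, abs_of_nonneg]
    linarith

theorem moment_phase (a b c e : Fin 2) :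
    moment a b c e = star (![1, Complex.I] a) * star (![1, Complex.I] b) * ![1, Complex.I] c *
      ![1, Complex.I] e * moment a b c e := by
  conv_lhs => rw [moment, ← integral_toSphere_comp phaseGate (continuous_quartic a b c e)]
  rw [moment, ← integral_const_mul]
  congr 1
  funext x
  have h (i : Fin 2) : phaseGate x i = ![1, Complex.I] i * (x : QubitSpace) i := by
    fin_cases i <;> simp [phaseGate]
  simp only [quartic, h, star_mul']
  ring

theorem moment_comm_left (a b c e : Fin 2) : moment a b c e = moment b a c e := by
  simp only [moment, quartic, mul_comm (star _) (star _)]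

theorem moment_comm_right (a b c e : Fin 2) : moment a b c e = moment a b e c := by
  simp only [moment, quartic, mul_right_comm]

/-- The phase gate multiplies the monomial by i to the power (number of ones in c, e) - (number of
ones in a, b). If the pairs differ as multisets this is i, -i or -1, so the invariant integral
vanishes. -/
theorem moment_eq_zero {a b c e : Fin 2} (h : ¬(a = c ∧ b = e)) (h' : ¬(a = e ∧ b = c)) :
    moment a b c e = 0 := by
  have hI : (1 - Complex.I : ℂ) ≠ 0 := fun h => by simpa using congrArg Complex.re h
  have hI' : (1 + Complex.I : ℂ) ≠ 0 := fun h => by simpa using congrArg Complex.re h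
  have hphase := moment_phase a b c e
  generalize moment a b c e = m at hphase
  have hcases : (1 - Complex.I) * m = 0 ∨ (1 + Complex.I) * m = 0 ∨ 2 * m = 0 := by
    fin_cases a <;> fin_cases b <;> fin_cases c <;> fin_cases e <;>
      simp at h h' hphase ⊢ <;> grind [Complex.I_mul_I]
  simpa [hI, hI'] using hcases

/-- Invariance under the Hadamard gate; the 4 clears its normalization (√2)⁻⁴. The right-hand side
does not depend on i, so the two cases give m₀₀₀₀ = m₁₁₁₁ = 2m₀₁₀₁. -/
theorem moment_hadamard (i : Fin 2) :
    4 * moment i i i i = moment 0 0 0 0 + moment 1 1 1 1 + 4 * moment 0 1 0 1 := by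
  -- The signs in row i of the Hadamard matrix.
  let η : Fin 2 → ℂ := ![1, if i = 0 then 1 else -1]
  have hη : star (η 1) = η 1 ∧ η 1 ^ 2 = 1 := by
    fin_cases i <;> simp [η]
  have hgate (x : QubitSpace) : hadamardGate x i = ((Real.sqrt 2)⁻¹ : ℝ) * (x 0 + η 1 * x 1) := by
    fin_cases i <;> simp [hadamardGate, η, sub_eq_add_neg]
  have hexpand (x : QubitSpace) : 4 * quartic i i i i (hadamardGate x) =
      ∑ a, ∑ b, ∑ c, ∑ e, η a * η b * η c * η e * quartic a b c e x := by
    have h2 : (((Real.sqrt 2)⁻¹ : ℝ) : ℂ) ^ 4 * 4 = 1 := by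
      have : (Real.sqrt 2)⁻¹ ^ 4 * 4 = 1 := by
        rw [inv_pow, show (Real.sqrt 2) ^ 4 = (Real.sqrt 2 ^ 2) ^ 2 by ring,
          Real.sq_sqrt (by norm_num)]
        norm_num
      exact_mod_cast this
    have hstar : star (η 1) = η 1 := hη.1
    simp only [quartic, hgate, star_mul', star_add, Complex.star_def, Complex.conj_ofReal]
    rw [← Complex.star_def, hstar]
    simp only [Fin.sum_univ_two, show η 0 = 1 from rfl, Complex.star_def]
    linear_combination (((starRingEnd ℂ) (x 0) + η 1 * (starRingEnd ℂ) (x 1)) ^ 2 *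
      (x 0 + η 1 * x 1) ^ 2) * h2
  have hint (a b c e : Fin 2) := integrable_toSphere (continuous_quartic a b c e)
  have hsum : 4 * moment i i i i =
      ∑ a, ∑ b, ∑ c, ∑ e, η a * η b * η c * η e * moment a b c e := by
    conv_lhs => rw [moment, ← integral_toSphere_comp hadamardGate (continuous_quartic i i i i),
      ← integral_const_mul]
    simp only [hexpand]
    rw [integral_finsetSum _ fun a _ => integrable_finsetSum _ fun b _ =>
      integrable_finsetSum _ fun c _ => integrable_finsetSum _ fun e _ =>
        (hint a b c e).const_mul _]
    refine Finset.sum_congr rfl fun a _ => ?_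
    rw [integral_finsetSum _ fun b _ =>
      integrable_finsetSum _ fun c _ => integrable_finsetSum _ fun e _ =>
        (hint a b c e).const_mul _]
    refine Finset.sum_congr rfl fun b _ => ?_
    rw [integral_finsetSum _ fun c _ => integrable_finsetSum _ fun e _ =>
        (hint a b c e).const_mul _]
    refine Finset.sum_congr rfl fun c _ => ?_
    rw [integral_finsetSum _ fun e _ => (hint a b c e).const_mul _]
    exact Finset.sum_congr rfl fun e _ => integral_const_mul _ _
  rw [hsum]
  simp only [Fin.sum_univ_two]
  rw [moment_comm_left 1 0 0 1, moment_comm_left 1 0 1 0, moment_comm_right 0 1 1 0,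
    moment_eq_zero (a := 0) (b := 0) (c := 0) (e := 1) (by decide) (by decide),
    moment_eq_zero (a := 0) (b := 0) (c := 1) (e := 0) (by decide) (by decide),
    moment_eq_zero (a := 0) (b := 1) (c := 0) (e := 0) (by decide) (by decide),
    moment_eq_zero (a := 1) (b := 0) (c := 0) (e := 0) (by decide) (by decide),
    moment_eq_zero (a := 0) (b := 0) (c := 1) (e := 1) (by decide) (by decide),
    moment_eq_zero (a := 1) (b := 1) (c := 0) (e := 0) (by decide) (by decide),
    moment_eq_zero (a := 1) (b := 1) (c := 0) (e := 1) (by decide) (by decide),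
    moment_eq_zero (a := 1) (b := 1) (c := 1) (e := 0) (by decide) (by decide),
    moment_eq_zero (a := 0) (b := 1) (c := 1) (e := 1) (by decide) (by decide),
    moment_eq_zero (a := 1) (b := 0) (c := 1) (e := 1) (by decide) (by decide)]
  simp only [show η 0 = 1 from rfl]
  linear_combination (moment 1 1 1 1 * (η 1 ^ 2 + 1) + 4 * moment 0 1 0 1) * hη.2

/-- Integrates (|x₀|² + |x₁|²)² = 1, which fixes the scale of the moments. -/
theorem moment_total :
    moment 0 0 0 0 + moment 1 1 1 1 + 2 * moment 0 1 0 1 =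
      (volume : Measure QubitSpace).toSphere.real Set.univ := by
  have h (x : Metric.sphere (0 : QubitSpace) 1) :
      quartic 0 0 0 0 x + quartic 1 1 1 1 x + 2 * quartic 0 1 0 1 x = 1 := by
    have hx := EuclideanSpace.norm_sq_eq (x : QubitSpace)
    rw [mem_sphere_zero_iff_norm.mp x.2, Fin.sum_univ_two] at hx
    have hx' := congrArg (fun r : ℝ => (r : ℂ) ^ 2) hx
    simp only [Complex.ofReal_add, ← Complex.normSq_eq_norm_sq, ← Complex.mul_conj] at hx'
    simp only [quartic, Complex.star_def]
    norm_num at hx'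
    linear_combination -hx'
  have hint (a b c e : Fin 2) := integrable_toSphere (continuous_quartic a b c e)
  have hadd := integral_add ((hint 0 0 0 0).add (hint 1 1 1 1)) ((hint 0 1 0 1).const_mul 2)
  have hadd' := integral_add (hint 0 0 0 0) (hint 1 1 1 1)
  simp only [Pi.add_apply, h, integral_const] at hadd hadd'
  rw [hadd', integral_const_mul] at hadd
  exact hadd.symm.trans (by simp)

theorem moment_eq (a b c e : Fin 2) :
    moment a b c e = (volume : Measure QubitSpace).toSphere.real Set.univ / 6 *
      ((if a = c ∧ b = e then 1 else 0) + if a = e ∧ b = c then 1 else 0) := by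
  have h0 := moment_hadamard 0
  have h1 := moment_hadamard 1
  have htot := moment_total
  by_cases h : a = c ∧ b = e
  · obtain ⟨rfl, rfl⟩ := h
    rcases eq_or_ne a b with rfl | hab
    · have : a = 0 ∨ a = 1 := by omega
      rcases this with rfl | rfl <;> simp only [and_self, if_true]
      · linear_combination (1 / 3) * htot + (5 / 24) * h0 - (1 / 24) * h1
      · linear_combination (1 / 3) * htot + (5 / 24) * h1 - (1 / 24) * h0
    · have h01 : moment a b a b = moment 0 1 0 1 := by
        have : (a = 0 ∧ b = 1) ∨ (a = 1 ∧ b = 0) := by omega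
        rcases this with ⟨rfl, rfl⟩ | ⟨rfl, rfl⟩
        · rfl
        · rw [moment_comm_left, moment_comm_right]
      rw [h01]
      simp only [hab, hab.symm, and_self, if_true, if_false]
      linear_combination (1 / 6) * htot - (1 / 12) * h0 - (1 / 12) * h1
  · by_cases h' : a = e ∧ b = c
    · obtain ⟨rfl, rfl⟩ := h'
      have hab : a ≠ b := fun hab => h ⟨hab, hab.symm⟩
      have h01 : moment a b b a = moment 0 1 0 1 := by
        have : (a = 0 ∧ b = 1) ∨ (a = 1 ∧ b = 0) := by omega
        rcases this with ⟨rfl, rfl⟩ | ⟨rfl, rfl⟩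
        · rw [moment_comm_right]
        · rw [moment_comm_left]
      rw [h01]
      simp only [hab, hab.symm, and_self, if_true, if_false]
      linear_combination (1 / 6) * htot - (1 / 12) * h0 - (1 / 12) * h1
    · rw [moment_eq_zero h h', if_neg h, if_neg h', add_zero, mul_zero]

end QubitMoments

/-! ### Average infidelity of a qubit map -/

section QubitInfidelity

theorem toSphere_real_univ_ne_zero :
    (volume : Measure QubitSpace).toSphere.real Set.univ ≠ 0 := by
  rw [Ne, measureReal_eq_zero_iff, Measure.measure_univ_eq_zero]
  exact Measure.toSphere_ne_zero _

/-- The two index pairings in the moments contract Φ to its entanglement fidelity term and to Tr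
Φ(1); the 6 is d(d + 1) at d = 2. -/
theorem infidelity_qubit (Φ : SuperOp (Fin 2)) :
    infidelity Φ = 1 - (∑ i, ∑ j, Φ (Matrix.single i j 1) i j +
      ∑ k, (Φ (Matrix.single k k 1)).trace).re / 6 := by
  have hexpand (x : QubitSpace) : (∑ i, ∑ j, star (x i) * Φ (ketBra x) i j * x j) =
      ∑ i, ∑ j, ∑ k, ∑ l, Φ (Matrix.single k l 1) i j * quartic i l j k x := by
    have hket : ketBra x = ∑ k, ∑ l, (x k * star (x l)) • Matrix.single k l (1 : ℂ) := by
      simp only [Matrix.smul_single, smul_eq_mul, mul_one]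
      exact Matrix.matrix_eq_sum_single _
    rw [hket]
    simp only [map_sum, map_smul, Matrix.sum_apply, Matrix.smul_apply, smul_eq_mul,
      Finset.mul_sum, Finset.sum_mul, quartic]
    refine Finset.sum_congr rfl fun i _ => Finset.sum_congr rfl fun j _ =>
      Finset.sum_congr rfl fun k _ => Finset.sum_congr rfl fun l _ => by ring
  have hint (a b c e : Fin 2) := integrable_toSphere (continuous_quartic a b c e)
  have hintegral : ∫ x : Metric.sphere (0 : QubitSpace) 1,
      (∑ i, ∑ j, star ((x : QubitSpace) i) * Φ (ketBra (x : QubitSpace)) i j *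
        (x : QubitSpace) j) ∂(volume : Measure QubitSpace).toSphere =
      ∑ i, ∑ j, ∑ k, ∑ l, Φ (Matrix.single k l 1) i j * moment i l j k := by
    simp only [hexpand]
    rw [integral_finsetSum _ fun i _ => integrable_finsetSum _ fun j _ =>
      integrable_finsetSum _ fun k _ => integrable_finsetSum _ fun l _ =>
        (hint i l j k).const_mul _]
    refine Finset.sum_congr rfl fun i _ => ?_
    rw [integral_finsetSum _ fun j _ =>
      integrable_finsetSum _ fun k _ => integrable_finsetSum _ fun l _ =>
        (hint i l j k).const_mul _]
    refine Finset.sum_congr rfl fun j _ => ?_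
    rw [integral_finsetSum _ fun k _ => integrable_finsetSum _ fun l _ =>
        (hint i l j k).const_mul _]
    refine Finset.sum_congr rfl fun k _ => ?_
    rw [integral_finsetSum _ fun l _ => (hint i l j k).const_mul _]
    exact Finset.sum_congr rfl fun l _ => integral_const_mul _ _
  have hintble : Integrable (fun x : Metric.sphere (0 : QubitSpace) 1 =>
      ∑ i, ∑ j, star ((x : QubitSpace) i) * Φ (ketBra (x : QubitSpace)) i j *
        (x : QubitSpace) j) (volume : Measure QubitSpace).toSphere := by
    simp only [hexpand]
    exact integrable_finsetSum _ fun i _ => integrable_finsetSum _ fun j _ =>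
      integrable_finsetSum _ fun k _ => integrable_finsetSum _ fun l _ =>
        (hint i l j k).const_mul _
  have hV := toSphere_real_univ_ne_zero
  set V := (volume : Measure QubitSpace).toSphere.real Set.univ with hVdef
  have hsum : ∑ i, ∑ j, ∑ k, ∑ l, Φ (Matrix.single k l 1) i j * moment i l j k =
      ((V / 6 : ℝ) : ℂ) * (∑ i, ∑ j, Φ (Matrix.single i j 1) i j +
        ∑ k, (Φ (Matrix.single k k 1)).trace) := by
    simp only [moment_eq, Matrix.trace, Matrix.diag_apply, Fin.sum_univ_two, ← hVdef]
    simp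
    ring
  unfold infidelity
  rw [average_eq, ← hVdef]
  have hre := integral_re hintble
  simp only [RCLike.re_eq_complex_re] at hre
  rw [hre, hintegral, hsum, Complex.re_ofReal_mul, smul_eq_mul]
  field_simp

/-- Trace preservation makes the second contraction equal to 2. The right-hand side is then the Choi
radicand at d = 2. -/
theorem six_mul_infidelity {Φ : SuperOp (Fin 2)} (hΦ : IsChannel Φ) :
    6 * infidelity Φ = 4 - (∑ i, ∑ j, Φ (Matrix.single i j 1) i j).re := by
  rw [infidelity_qubit, Complex.add_re]
  simp only [hΦ.trace_preserving, Matrix.trace_single_eq_same, Finset.sum_const, Finset.card_univ,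
    Fintype.card_fin]
  norm_num
  ring

theorem stableBound_sub_id_qubit {Φ : SuperOp (Fin 2)} (hΦ : IsChannel Φ) :
    StableBound (Φ - LinearMap.id) (2 * Real.sqrt (6 * infidelity Φ)) := by
  have h := stableBound_sub_id hΦ
  rwa [Fintype.card_fin, show ((2 : ℕ) : ℝ) ^ 2 = 4 by norm_num, ← six_mul_infidelity hΦ] at h

theorem six_mul_infidelity_nonneg {Φ : SuperOp (Fin 2)} (hΦ : IsChannel Φ) :
    0 ≤ 6 * infidelity Φ := by
  have h := sum_apply_single_le hΦ
  rw [Fintype.card_fin, show ((2 : ℕ) : ℝ) ^ 2 = 4 by norm_num] at h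
  rw [six_mul_infidelity hΦ]
  exact sub_nonneg.mpr h

/-- The closed form is 1 minus a real-linear functional of the map, so averages pass through. -/
theorem infidelity_expect {σ : Type*} {s : Finset σ} (hs : s.Nonempty)
    (Φ : σ → SuperOp (Fin 2)) :
    infidelity (𝔼 t ∈ s, Φ t) = 𝔼 t ∈ s, infidelity (Φ t) := by
  have hc : (s.card : ℝ) ≠ 0 := Nat.cast_ne_zero.mpr hs.card_ne_zero
  let f : SuperOp (Fin 2) →ₗ[ℝ] ℝ :=
    { toFun := fun Ψ => (∑ i, ∑ j, Ψ (Matrix.single i j 1) i j +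
        ∑ k, (Ψ (Matrix.single k k 1)).trace).re / 6
      map_add' := fun Ψ Θ => by
        simp only [LinearMap.add_apply, Matrix.add_apply, trace_add, Finset.sum_add_distrib,
          Complex.add_re]
        ring
      map_smul' := fun c Ψ => by
        simp only [LinearMap.smul_apply, Matrix.smul_apply, trace_smul, ← Finset.smul_sum,
          Complex.add_re, Complex.smul_re, RingHom.id_apply, smul_eq_mul]
        ring }
  have hf (Ψ : SuperOp (Fin 2)) : infidelity Ψ = 1 - f Ψ := infidelity_qubit Ψ
  simp only [hf]
  rw [Finset.expect_sub_distrib, Finset.expect_const hs, expect_eq_smul_sum, expect_eq_smul_sum,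
    map_smul, map_sum]

end QubitInfidelity

/-! ### The bound for local noise on qubits -/

namespace Circuit

variable {n K : ℕ} (Q : Circuit 2 n K)

theorem expect_diamondNorm_sub_averagedNoise_le_of_local
    (E : (Fin n → Q.easy) → SuperOp (Qudits n 2)) (Eloc : Fin n → Q.easy → SuperOp (Fin 2))
    (hloc : ∀ j c, IsChannel (Eloc j c)) (hE : ∀ C, E C = tensorSuperOp fun j => Eloc j (C j))
    (k : Fin K) :
    𝔼 T ∈ Q.twirlPairs k, diamondNorm (E (Q.dressed k T) - Q.averagedNoise k E) ≤
      ∑ j : Fin n, 4 * Real.sqrt (6 * infidelity (Q.averagedLocalNoise k j (Eloc j))) := by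
  have hne := Q.twirlPairs_nonempty k
  set c : (Fin n → Q.easy) × (Fin n → Q.easy) → ℝ := fun T =>
    ∑ j, 2 * Real.sqrt (6 * infidelity (Eloc j (Q.dressed k T j))) with hcdef
  have hcnn (T) : 0 ≤ c T :=
    Finset.sum_nonneg fun j _ => mul_nonneg (by norm_num) (Real.sqrt_nonneg _)
  have hlocal (T : (Fin n → Q.easy) × (Fin n → Q.easy)) : IsChannel (E (Q.dressed k T)) ∧
      StableBound (E (Q.dressed k T) - LinearMap.id) (c T) := by
    rw [hE]
    exact isChannel_tensorSuperOp_and_stableBound (fun j => hloc j _)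
      fun j => stableBound_sub_id_qubit (hloc j _)
  have havg : IsChannel (Q.averagedNoise k E) := IsChannel.expect hne fun T _ => (hlocal T).1
  -- The averaged noise may correlate the qubits, so it is bounded by convexity from the product
  -- channels rather than factor by factor.
  have hbound : diamondNorm (Q.averagedNoise k E - LinearMap.id) ≤ 𝔼 T ∈ Q.twirlPairs k, c T :=
    (StableBound.expect hne (fun T _ => (hlocal T).1) fun T _ => (hlocal T).2).diamondNorm_le
      (Finset.expect_nonneg fun T _ => hcnn T)
  calc 𝔼 T ∈ Q.twirlPairs k, diamondNorm (E (Q.dressed k T) - Q.averagedNoise k E)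
      ≤ 𝔼 T ∈ Q.twirlPairs k, (c T + 𝔼 T ∈ Q.twirlPairs k, c T) :=
        Finset.expect_le_expect fun T _ => (diamondNorm_sub_le (hlocal T).1 havg isChannel_id).trans
          (add_le_add ((hlocal T).2.diamondNorm_le (hcnn T)) hbound)
    _ = 2 * 𝔼 T ∈ Q.twirlPairs k, c T := by
        rw [Finset.expect_add_distrib, Finset.expect_const hne, two_mul]
    _ = ∑ j, 4 * 𝔼 T ∈ Q.twirlPairs k,
          Real.sqrt (6 * infidelity (Eloc j (Q.dressed k T j))) := by
        rw [hcdef, Finset.expect_sum_comm, Finset.mul_sum]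
        refine Finset.sum_congr rfl fun j _ => ?_
        rw [← Finset.mul_expect]
        ring
    _ ≤ _ := by
        refine Finset.sum_le_sum fun j _ => mul_le_mul_of_nonneg_left ?_ (by norm_num)
        -- The mean moves under the root; since 6r ≥ 0 the squares cancel the roots, leaving the
        -- mean of 6r, which is 6r of the averaged local noise.
        refine (expect_le_sqrt_expect_sq _ _).trans (Real.sqrt_le_sqrt ?_)
        rw [averagedLocalNoise, infidelity_expect hne, Finset.mul_expect]
        exact (Finset.expect_congr rfl fun T _ =>
          Real.sq_sqrt (six_mul_infidelity_nonneg (hloc j _))).le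

end Circuit

end RandomizedCompiling

end

theorem theorem3 :
    (∀ (d n K : ℕ) (Q : RandomizedCompiling.Circuit d n K)
      (E : (Fin n → Q.easy) → RandomizedCompiling.SuperOp (RandomizedCompiling.Qudits n d))
      (_ : ∀ C, RandomizedCompiling.IsChannel (E C)) (k : Fin K),
      𝔼 T ∈ Q.twirlPairs k,
          RandomizedCompiling.diamondNorm (E (Q.dressed k T) - Q.averagedNoise k E) ≤
        2 * RandomizedCompiling.worstCaseError (Q.averagedNoise k E) +
          2 * Real.sqrt (𝔼 T ∈ Q.twirlPairs k,
            RandomizedCompiling.worstCaseError (E (Q.dressed k T)) ^ 2)) ∧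
    (∀ (n K : ℕ) (Q : RandomizedCompiling.Circuit 2 n K)
      (E : (Fin n → Q.easy) → RandomizedCompiling.SuperOp (RandomizedCompiling.Qudits n 2))
      (Eloc : Fin n → Q.easy → RandomizedCompiling.SuperOp (Fin 2))
      (_ : ∀ j c, RandomizedCompiling.IsChannel (Eloc j c))
      (_ : ∀ C, E C = RandomizedCompiling.tensorSuperOp fun j => Eloc j (C j)) (k : Fin K),
      𝔼 T ∈ Q.twirlPairs k,
          RandomizedCompiling.diamondNorm (E (Q.dressed k T) - Q.averagedNoise k E) ≤
        ∑ j : Fin n, 4 * Real.sqrt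
          (6 * RandomizedCompiling.infidelity (Q.averagedLocalNoise k j (Eloc j)))) :=
  ⟨fun _ _ _ Q E hE k => Q.expect_diamondNorm_sub_averagedNoise_le E hE k,
    fun _ _ Q E Eloc hloc hE k =>
      Q.expect_diamondNorm_sub_averagedNoise_le_of_local E Eloc hloc hE k⟩
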